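/- Let $n\ge 1$, let $|\cdot|$ denote Lebesgue measure on $\mathbb{R}^n$, let $B(0,r)$ be the open Euclidean ball of radius $r$ centred at $0$, and let $v_n=|B(0,1)|$. For $y_1,\dots,y_{n+1}\in\mathbb{R}^n$ put $$\det(y_1,\dots,y_{n+1}) := n!\,\mathrm{vol}\big(\mathrm{co}\{y_1,\dots,y_{n+1}\}\big)\ \ge 0 .$$ Set $$A_n = v_n,\qquad B_n = v_n\,\frac{n^{n/2}}{(n+1)^{(n+1)/2}} .$$ Suprema are taken in $[0,\infty]$, with $\sup\emptyset=0$ and $0\cdot\infty=0$. (i) For all Lebesgue measurable sets $E_1,\dots,E_n\subset\mathbb{R}^n$, $$\prod_{j=1}^{n}|E_j|^{1/n}\le A_n\sup_{y_j\in E_j}\det(0,y_1,\dots,y_n),$$ and $A_n$ is the smallest constant in $[0,\infty]$ for which this holds. Equality holds whenever $E_j=B(0,r_j)$ with arbitrary $r_1,\dots,r_n>0$. (ii) For all Lebesgue measurable sets $E_1,\dots,E_{n+1}\subset\mathbb{R}^n$, $$\prod_{j=1}^{n+1}|E_j|^{1/(n+1)}\le B_n\sup_{y_j\in E_j}\det(y_1,\dots,y_{n+1}),$$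 and $B_n$ is the smallest constant in $[0,\infty]$ for which this holds. For balls $E_j=B(0,r_j)$ with $r_1,\dots,r_{n+1}>0$, equality holds if and only if $r_1=\dots=r_{n+1}$. (iii) For every Lebesgue measurable set $E\subset\mathbb{R}^n$, $$|E|\le A_n\sup_{y_1,\dots,y_n\in E}\det(0,y_1,\dots,y_n),$$ and $A_n$ is the smallest constant in $[0,\infty]$ for which this holds. Equality holds for every ball centred at $0$, and more generally for every ellipsoid $T(B(0,r))$ with $r>0$ and $T\in\mathrm{GL}_n(\mathbb{R})$. (iv) For every Lebesgue measurable set $E\subset\mathbb{R}^n$, $$|E|\le B_n\sup_{y_1,\dots,y_{n+1}\in E}\det(y_1,\dots,y_{n+1}),$$ and $B_n$ is the smallest constant in $[0,\infty]$ for which this holds. Equality holds for every ball, and more generally for every ellipsoid $a+T(B(0,r))$ with $a\in\mathbb{R}^n$, $r>0$ and $T\in\mathrm{GL}_n(\mathbb{R})$. -/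

import Mathlib

open MeasureTheory
open scoped ENNReal

/-- The determinant functional of `n + 1` points of `ℝⁿ`:
`det(y₁, …, yₙ₊₁) = n! · vol (co {y₁, …, yₙ₊₁})`, a nonnegative quantity. -/
noncomputable def pointDet {n : ℕ} (y : Fin (n + 1) → EuclideanSpace ℝ (Fin n)) : ℝ≥0∞ :=
  (n.factorial : ℝ≥0∞) * volume (convexHull ℝ (Set.range y))

/-- The supremum of `det(0, y₁, …, yₙ)` over `y₁ ∈ E₁, …, yₙ ∈ Eₙ`. -/
noncomputable def supDetZero {n : ℕ} (E : Fin n → Set (EuclideanSpace ℝ (Fin n))) : ℝ≥0∞ :=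
  ⨆ (y : Fin n → EuclideanSpace ℝ (Fin n)) (_ : ∀ j, y j ∈ E j), pointDet (Fin.cons 0 y)

/-- The supremum of `det(y₁, …, yₙ₊₁)` over `y₁ ∈ E₁, …, yₙ₊₁ ∈ Eₙ₊₁`. -/
noncomputable def supDet {n : ℕ} (E : Fin (n + 1) → Set (EuclideanSpace ℝ (Fin n))) : ℝ≥0∞ :=
  ⨆ (y : Fin (n + 1) → EuclideanSpace ℝ (Fin n)) (_ : ∀ j, y j ∈ E j), pointDet y

/-- `Aₙ = vₙ`, the volume of the unit ball of `ℝⁿ`. -/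
noncomputable def constA (n : ℕ) : ℝ≥0∞ :=
  volume (Metric.ball (0 : EuclideanSpace ℝ (Fin n)) 1)

/-- `Bₙ = vₙ · n^{n/2} / (n+1)^{(n+1)/2}`. The factor by which `vₙ` is divided is `n!` times the
volume of a regular `n`-simplex inscribed in the unit sphere. -/
noncomputable def constB (n : ℕ) : ℝ≥0∞ :=
  volume (Metric.ball (0 : EuclideanSpace ℝ (Fin n)) 1) *
    ENNReal.ofReal ((n : ℝ) ^ ((n : ℝ) / 2) / ((n : ℝ) + 1) ^ (((n : ℝ) + 1) / 2))

theorem volume_cornerSimplex (n : ℕ) : ∀ t : ℝ, 0 ≤ t →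
    volume {x : Fin n → ℝ | (∀ i, 0 ≤ x i) ∧ ∑ i, x i ≤ t} =
      ENNReal.ofReal (t ^ n / n.factorial) := by
  induction n with
  | zero =>
    intro t ht
    have : {x : Fin 0 → ℝ | (∀ i, 0 ≤ x i) ∧ ∑ i, x i ≤ t} = Set.univ := by
      ext x; simp [ht]
    rw [this, volume_pi, Measure.pi_of_empty]
    simp
  | succ n ih =>
    intro t ht
    set S : Set (ℝ × (Fin n → ℝ)) :=
      {p | 0 ≤ p.1 ∧ (∀ i, 0 ≤ p.2 i) ∧ p.1 + ∑ i, p.2 i ≤ t} with hS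
    have hSm : MeasurableSet S := by
      apply IsClosed.measurableSet
      have h1 : IsClosed {p : ℝ × (Fin n → ℝ) | 0 ≤ p.1} :=
        isClosed_le continuous_const continuous_fst
      have h2 : IsClosed {p : ℝ × (Fin n → ℝ) | ∀ i, 0 ≤ p.2 i} := by
        simp only [Set.ofPred_forall]
        exact isClosed_iInter fun i => isClosed_le continuous_const (by fun_prop)
      have h3 : IsClosed {p : ℝ × (Fin n → ℝ) | p.1 + ∑ i, p.2 i ≤ t} :=
        isClosed_le (by fun_prop) continuous_const
      exact h1.inter (h2.inter h3)
    have hpre : {x : Fin (n + 1) → ℝ | (∀ i, 0 ≤ x i) ∧ ∑ i, x i ≤ t} =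
        (MeasurableEquiv.piFinSuccAbove (fun _ : Fin (n + 1) => ℝ) 0) ⁻¹' S := by
      ext x
      simp [hS, Fin.forall_fin_succ, Fin.sum_univ_succ, Fin.tail, and_assoc]
    rw [hpre, (volume_preserving_piFinSuccAbove (fun _ : Fin (n + 1) => ℝ) 0).measure_preimage
      hSm.nullMeasurableSet, Measure.volume_eq_prod, Measure.prod_apply hSm]
    have hsec : ∀ a : ℝ, volume (Prod.mk a ⁻¹' S) =
        (Set.Icc 0 t).indicator (fun a => ENNReal.ofReal ((t - a) ^ n / n.factorial)) a := by
      intro a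
      by_cases ha : a ∈ Set.Icc 0 t
      · rw [Set.indicator_of_mem ha, ← ih (t - a) (by linarith [ha.2])]
        congr 1
        ext x
        simp only [hS, Set.mem_preimage, Set.mem_ofPred_eq]
        constructor
        · rintro ⟨_, h2, h3⟩; exact ⟨h2, by linarith⟩
        · rintro ⟨h2, h3⟩; exact ⟨ha.1, h2, by linarith⟩
      · rw [Set.indicator_of_notMem ha]
        have : Prod.mk a ⁻¹' S = ∅ := by
          ext x
          simp only [hS, Set.mem_preimage, Set.mem_ofPred_eq, Set.mem_empty_iff_false, iff_false]
          rintro ⟨h1, h2, h3⟩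
          exact ha ⟨h1, by linarith [Finset.sum_nonneg fun i (_ : i ∈ Finset.univ) => h2 i]⟩
        rw [this, measure_empty]
    simp_rw [hsec]
    rw [lintegral_indicator measurableSet_Icc,
      ← ofReal_integral_eq_lintegral_ofReal]
    · congr 1
      rw [integral_Icc_eq_integral_Ioc, ← intervalIntegral.integral_of_le ht,
        intervalIntegral.integral_div,
        intervalIntegral.integral_comp_sub_left (fun x : ℝ => x ^ n) t, integral_pow]
      simp only [sub_self, sub_zero, Nat.factorial_succ]
      push_cast
      field_simp
      simp
    · exact (Continuous.integrableOn_Icc (by fun_prop))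
    · refine (ae_restrict_iff' measurableSet_Icc).2 (Filter.Eventually.of_forall fun a ha => ?_)
      have : 0 ≤ t - a := by linarith [ha.2]
      positivity

/-- The determinant functional is the absolute value of the determinant of the matrix of the
differences `yⱼ - y₀`. -/
theorem pointDet_eq_abs_det {n : ℕ} (y : Fin (n + 1) → EuclideanSpace ℝ (Fin n)) :
    pointDet y = ENNReal.ofReal |(Matrix.of fun i j : Fin n => y j.succ i - y 0 i).det| := by
  set M : Matrix (Fin n) (Fin n) ℝ := Matrix.of fun i j : Fin n => y j.succ i - y 0 i with hM
  set T : Set (Fin n → ℝ) := {x | (∀ i, 0 ≤ x i) ∧ ∑ i, x i ≤ 1} with hT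
  have hhull : convexHull ℝ (Set.range y) =
      WithLp.ofLp ⁻¹' ((fun v => (WithLp.ofLp (y 0)) + v) '' (Matrix.toLin' M '' T)) := by
    have h0 : convexHull ℝ (Set.range y) =
        {z | ∃ w : Fin (n + 1) → ℝ, (∀ i, 0 ≤ w i) ∧ ∑ i, w i = 1 ∧ ∑ i, w i • y i = z} := by
      ext z
      rw [Set.mem_ofPred_eq]
      constructor
      · intro hz
        rw [convexHull_range_eq_exists_affineCombination] at hz
        obtain ⟨s, w, hw, hw1, rfl⟩ := hz
        refine ⟨fun i => if i ∈ s then w i else 0, fun i => ?_, ?_, ?_⟩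
        · dsimp only
          split_ifs with h
          · exact hw i h
          · exact le_rfl
        · simpa using hw1
        · rw [Finset.affineCombination_eq_linear_combination _ _ _ hw1]
          simp [ite_smul]
      · rintro ⟨w, hw, hw1, rfl⟩
        exact (convex_convexHull ℝ _).sum_mem (fun i _ => hw i) hw1
          (fun i _ => subset_convexHull ℝ _ ⟨i, rfl⟩)
    have key : ∀ (w : Fin n → ℝ) (k : Fin n), y 0 k + (M.mulVec w) k =
        (1 - ∑ i, w i) * y 0 k + ∑ i : Fin n, w i * y i.succ k := by
      intro w k
      simp only [hM, Matrix.mulVec, dotProduct, Matrix.of_apply]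
      have : ∑ x, (y x.succ k - y 0 k) * w x =
          ∑ x, w x * y x.succ k - (∑ x, w x) * y 0 k := by
        rw [Finset.sum_mul, ← Finset.sum_sub_distrib]
        exact Finset.sum_congr rfl fun _ _ => by ring
      rw [this]; ring
    rw [h0]
    ext z
    simp only [Set.mem_ofPred_eq, Set.mem_preimage, Set.mem_image, exists_exists_and_eq_and,
      Matrix.toLin'_apply]
    constructor
    · rintro ⟨w, hw, hw1, rfl⟩
      rw [Fin.sum_univ_succ] at hw1
      refine ⟨fun i => w i.succ, ⟨fun i => hw _, by linarith [hw 0]⟩, ?_⟩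
      funext k
      rw [Pi.add_apply, key, ← eq_sub_of_add_eq hw1, Fin.sum_univ_succ]
      simp
    · rintro ⟨w, ⟨hw, hw1⟩, hz⟩
      refine ⟨Fin.cons (1 - ∑ i, w i) w, ?_, ?_, ?_⟩
      · intro i
        refine Fin.cases ?_ (fun i => ?_) i
        · simpa using hw1
        · simpa using hw i
      · simp [Fin.sum_univ_succ]
      · ext k
        rw [← hz, Pi.add_apply, key, Fin.sum_univ_succ]
        simp
  have hTm : MeasurableSet T := by
    apply IsClosed.measurableSet
    have h2 : IsClosed {p : Fin n → ℝ | ∀ i, 0 ≤ p i} := by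
      simp only [Set.ofPred_forall]
      exact isClosed_iInter fun i => isClosed_le continuous_const (by fun_prop)
    have h3 : IsClosed {p : Fin n → ℝ | ∑ i, p i ≤ 1} :=
      isClosed_le (by fun_prop) continuous_const
    exact h2.inter h3
  have hvol := (EuclideanSpace.volume_preserving_symm_measurableEquiv_toLp (Fin n)).measure_preimage_equiv
    ((fun v => (WithLp.ofLp (y 0)) + v) '' (Matrix.toLin' M '' T))
  have hf : ((n.factorial : ℕ) : ℝ) ≠ 0 := by positivity
  rw [pointDet, hhull]
  refine (congrArg _ hvol).trans ?_
  rw [Set.image_add_left, measure_preimage_add, Measure.addHaar_image_linearMap,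
    LinearMap.det_toLin', hT, volume_cornerSimplex n 1 zero_le_one, ← ENNReal.ofReal_natCast,
    ← ENNReal.ofReal_mul (abs_nonneg _), ← ENNReal.ofReal_mul (by positivity)]
  congr 1
  rw [one_pow]
  field_simp

/-! The multilinear inequalities are rearrangement inequalities: among sets of prescribed volumes,
centred balls minimize the supremum of the determinant, so only balls need to be examined.

The reason is that, with all coordinates except the first fixed, the determinant is the absolute
value of a linear form in the first coordinates of the points. Steiner symmetrization of all sets at
once therefore does not increase the supremum (`exists_mem_abs_sum_le`, `IsAdmissible.steiner`). No
convergence of iterated symmetrizations is needed. If some set misses its target ball by volume at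
least `d`, then a suitable isometry followed by a symmetrization lowers the total missed volume by a
fixed multiple of `d * d` (`IsAdmissible.exists_deficit_add_le`), so finitely many steps make every
missed volume as small as desired. Since the balls are open and the functional is continuous, this
already gives the bound on balls (`IsSteinerMonotone.le_of_forall_mem`).

For balls, Hadamard's inequality settles the case with a vertex at the origin. With all vertices
free, a regular simplex with its vertices moved radially onto the spheres bounds the supremum from
below, and the arithmetic-geometric mean inequality compares this bound with the volumes. That
inequality is strict for unequal radii. For equal radii, Hadamard's inequality in one dimension
higher shows that the regular simplex is optimal. -/

/-! ### Steiner symmetrization along one coordinate. -/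

section Steiner

variable {Y : Type*}

/-- The Steiner symmetrization of `A ⊆ ℝ × Y` along the first coordinate. -/
def steiner (A : Set (ℝ × Y)) : Set (ℝ × Y) :=
  {p | ENNReal.ofReal (2 * |p.1|) < volume ((fun t : ℝ => (t, p.2)) ⁻¹' A)}

theorem steiner_mono {A B : Set (ℝ × Y)} (h : A ⊆ B) : steiner A ⊆ steiner B := fun _ hp =>
  lt_of_lt_of_le hp (measure_mono (Set.preimage_mono h))

theorem volume_setOf_two_mul_abs_lt (l : ℝ≥0∞) :
    volume {t : ℝ | ENNReal.ofReal (2 * |t|) < l} = l := by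
  induction l with
  | top => simp [lt_top_iff_ne_top, ENNReal.mul_eq_top]
  | coe l =>
    have : {t : ℝ | ENNReal.ofReal (2 * |t|) < l} = Set.Ioo (-(l / 2 : ℝ)) (l / 2) := by
      ext t
      rw [Set.mem_ofPred_eq, Set.mem_Ioo, ← abs_lt, ← ENNReal.ofReal_coe_nnreal,
        ENNReal.ofReal_lt_ofReal_iff_of_nonneg (by positivity)]
      constructor <;> intro h <;> linarith
    rw [this, Real.volume_Ioo]
    ring_nf
    simp

theorem preimage_steiner (A : Set (ℝ × Y)) (y : Y) : (fun t : ℝ => (t, y)) ⁻¹' steiner A =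
    {t : ℝ | ENNReal.ofReal (2 * |t|) < volume ((fun t : ℝ => (t, y)) ⁻¹' A)} := rfl

/-- Centred intervals are nested, so the shorter one is the intersection. -/
theorem preimage_steiner_inter (A B : Set (ℝ × Y)) (y : Y) :
    volume ((fun t : ℝ => (t, y)) ⁻¹' (steiner A ∩ steiner B)) =
      min (volume ((fun t : ℝ => (t, y)) ⁻¹' A)) (volume ((fun t : ℝ => (t, y)) ⁻¹' B)) := by
  rw [← volume_setOf_two_mul_abs_lt (min _ _)]
  congr 1
  ext t
  simp [steiner]

variable [MeasurableSpace Y]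

theorem measurableSet_steiner {A : Set (ℝ × Y)} (hA : MeasurableSet A) :
    MeasurableSet (steiner A) :=
  measurableSet_lt (by fun_prop) ((measurable_measure_prodMk_right hA).comp measurable_snd)

variable (ν : Measure Y) [SFinite ν]

theorem prod_steiner {A : Set (ℝ × Y)} (hA : MeasurableSet A) :
    (volume.prod ν) (steiner A) = (volume.prod ν) A := by
  rw [Measure.prod_apply_symm (measurableSet_steiner hA), Measure.prod_apply_symm hA]
  simp_rw [preimage_steiner, volume_setOf_two_mul_abs_lt]

/-- Symmetrization makes the sections of `A` and `B` overlap as much as their lengths allow. On each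
line, `W` adds length to `A` outside `A ∩ B`, and its translate adds the same length to `B`; hence
the smaller of the two lengths exceeds that of the old overlap by at least that of `W`. -/
theorem prod_inter_add_le_prod_steiner_inter {A B W : Set (ℝ × Y)} (hA : MeasurableSet A)
    (hB : MeasurableSet B) (hW : MeasurableSet W) (hBs : steiner B = B) (hWA : W ⊆ A \ B) (s : ℝ)
    (hWs : ∀ p ∈ W, (p.1 - s, p.2) ∈ B \ A) :
    (volume.prod ν) (A ∩ B) + (volume.prod ν) W ≤ (volume.prod ν) (steiner A ∩ B) := by
  nth_rw 2 [← hBs]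
  rw [Measure.prod_apply_symm ((measurableSet_steiner hA).inter (measurableSet_steiner hB)),
    Measure.prod_apply_symm (hA.inter hB), Measure.prod_apply_symm hW,
    ← lintegral_add_left (measurable_measure_prodMk_right (hA.inter hB))]
  refine lintegral_mono fun y => ?_
  rw [preimage_steiner_inter, le_min_iff]
  have hm : ∀ {C : Set (ℝ × Y)}, MeasurableSet C →
      MeasurableSet ((fun t : ℝ => (t, y)) ⁻¹' C) := fun hC => measurable_prodMk_right hC
  constructor
  · rw [← measure_union _ (hm hW)]
    · refine measure_mono ?_
      rintro t (ht | ht)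
      · exact ht.1
      · exact (hWA ht).1
    · rw [Set.disjoint_left]
      intro t h1 h2
      exact (hWA h2).2 h1.2
  · have h : volume ((fun t : ℝ => (t, y)) ⁻¹' W) =
        volume ((fun t : ℝ => t + s) ⁻¹' ((fun t : ℝ => (t, y)) ⁻¹' W)) :=
      (measure_preimage_add_right _ _ _).symm
    have hm' : MeasurableSet ((fun t : ℝ => t + s) ⁻¹' ((fun t : ℝ => (t, y)) ⁻¹' W)) :=
      (measurable_add_const s) (hm hW)
    have hsub : ∀ t, (t + s, y) ∈ W → (t, y) ∈ B \ A := fun t ht => by simpa using hWs _ ht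
    rw [h, ← measure_union _ hm']
    · refine measure_mono ?_
      rintro t (ht | ht)
      · exact ht.2
      · exact (hsub t ht).1
    · rw [Set.disjoint_left]
      intro t h1 h2
      exact (hsub t h2).2 h1.1

end Steiner

/-! ### Linear forms on products of linear sets, and overlaps under translation. -/

theorem exists_mem_add_le_of_ofReal_lt_volume {F : Set ℝ} {d : ℝ}
    (h : ENNReal.ofReal d < volume F) : ∃ a ∈ F, ∃ b ∈ F, a + d ≤ b := by
  by_contra! hc
  refine absurd (Real.volume_le_diam F) (not_le.2 (lt_of_le_of_lt ?_ h))
  refine Metric.ediam_le fun x hx y hy => ?_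
  rw [edist_dist, Real.dist_eq]
  refine ENNReal.ofReal_le_ofReal (abs_le.2 ⟨?_, ?_⟩)
  · linarith [hc x hx y hy]
  · linarith [hc y hy x hx]

/-- A linear form on a product of subsets of `ℝ` is at least as large somewhere as on the product
of the centred intervals of the same lengths. -/
theorem exists_mem_abs_sum_le {ι : Type*} [Fintype ι] (c t : ι → ℝ) (F : ι → Set ℝ)
    (h : ∀ j, ENNReal.ofReal (2 * |t j|) < volume (F j)) :
    ∃ s : ι → ℝ, (∀ j, s j ∈ F j) ∧ |∑ j, c j * t j| ≤ |∑ j, c j * s j| := by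
  have h1 : ∀ j, ∃ p ∈ F j, ∃ q ∈ F j, c j * q + 2 * |c j * t j| ≤ c j * p := by
    intro j
    obtain ⟨a, ha, b, hb, hab⟩ := exists_mem_add_le_of_ofReal_lt_volume (h j)
    rcases le_total 0 (c j) with hc | hc
    · refine ⟨b, hb, a, ha, ?_⟩
      rw [abs_mul, abs_of_nonneg hc]
      nlinarith
    · refine ⟨a, ha, b, hb, ?_⟩
      rw [abs_mul, abs_of_nonpos hc]
      nlinarith
  choose p hp q hq hpq using h1
  -- From `q` to `p` the form rises by at least twice the value to be beaten, so it cannot be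
  -- smaller than that value in modulus at both points.
  have h2 : ∑ j, c j * q j + 2 * |∑ j, c j * t j| ≤ ∑ j, c j * p j :=
    calc ∑ j, c j * q j + 2 * |∑ j, c j * t j|
        ≤ ∑ j, c j * q j + 2 * ∑ j, |c j * t j| := by gcongr; exact Finset.abs_sum_le_sum_abs _ _
      _ = ∑ j, (c j * q j + 2 * |c j * t j|) := by rw [Finset.sum_add_distrib, Finset.mul_sum]
      _ ≤ _ := Finset.sum_le_sum fun j _ => hpq j
  by_cases h3 : |∑ j, c j * t j| ≤ |∑ j, c j * p j|
  · exact ⟨p, hp, h3⟩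
  · refine ⟨q, hq, ?_⟩
    have := le_abs_self (∑ j, c j * p j)
    have := neg_le_abs (∑ j, c j * q j)
    linarith

/-- The average over `v` of the measure of `P ∩ (Q + v)` gives a shift with a large intersection. -/
theorem exists_shift_measure_inter_le {G : Type*} [NormedAddCommGroup G] [MeasurableSpace G]
    [BorelSpace G] [SecondCountableTopology G] (μ : Measure G) [SFinite μ] [μ.IsAddLeftInvariant]
    [μ.IsNegInvariant]
    {P Q : Set G} (hP : MeasurableSet P) (hQ : MeasurableSet Q) {R : ℝ}
    (hPR : P ⊆ Metric.ball 0 R) (hQR : Q ⊆ Metric.ball 0 R) (hC : μ (Metric.ball 0 (2 * R)) ≠ 0)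
    (hC' : μ (Metric.ball 0 (2 * R)) ≠ ∞) :
    ∃ v : G, μ P * μ Q / μ (Metric.ball 0 (2 * R)) ≤ μ (P ∩ (fun x => x - v) ⁻¹' Q) := by
  set C := μ (Metric.ball 0 (2 * R))
  set T : Set (G × G) := {p | p.1 ∈ P ∧ p.1 - p.2 ∈ Q} with hT
  have hTm : MeasurableSet T :=
    (measurable_fst hP).inter ((measurable_fst.sub measurable_snd) hQ)
  have h1 : (μ.prod μ) T = μ P * μ Q := by
    rw [Measure.prod_apply hTm]
    have : ∀ x, μ (Prod.mk x ⁻¹' T) = P.indicator (fun _ => μ Q) x := by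
      intro x
      by_cases hx : x ∈ P
      · rw [Set.indicator_of_mem hx, ← (Measure.measurePreserving_sub_left μ x).measure_preimage hQ.nullMeasurableSet]
        congr 1
        ext v
        simp [hT, hx]
      · rw [Set.indicator_of_notMem hx]
        convert measure_empty (μ := μ)
        ext v
        simp [hT, hx]
    simp_rw [this]
    rw [lintegral_indicator_const hP, mul_comm]
  -- Differences of points of `P` and `Q` have norm below `2 * R`, so only shifts in that ball
  -- contribute.
  have h2 : (μ.prod μ) T = ∫⁻ v in Metric.ball 0 (2 * R), μ (P ∩ (fun x => x - v) ⁻¹' Q) ∂μ := by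
    rw [Measure.prod_apply_symm hTm, ← lintegral_indicator Metric.isOpen_ball.measurableSet]
    refine lintegral_congr fun v => ?_
    by_cases hv : v ∈ Metric.ball (0 : G) (2 * R)
    · rw [Set.indicator_of_mem hv]
      rfl
    · rw [Set.indicator_of_notMem hv]
      convert measure_empty (μ := μ)
      ext x
      simp only [hT, Set.mem_preimage, Set.mem_ofPred_eq, Set.mem_empty_iff_false, iff_false]
      rintro ⟨h3, h4⟩
      apply hv
      have h5 := hPR h3
      have h6 := hQR h4
      rw [mem_ball_zero_iff] at *
      calc ‖v‖ = ‖x - (x - v)‖ := by congr 1; abel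
        _ ≤ ‖x‖ + ‖x - v‖ := norm_sub_le _ _
        _ < 2 * R := by linarith
  by_cases htop : (μ.prod μ) T = ∞
  · exfalso
    rw [h1] at htop
    have hR : μ (Metric.ball 0 R) ≠ ∞ := by
      by_cases hR : 0 ≤ R
      · exact ne_top_of_le_ne_top hC' (measure_mono (Metric.ball_subset_ball (by linarith)))
      · rw [Metric.ball_eq_empty.2 (by linarith)]
        simp
    exact ENNReal.mul_ne_top (ne_top_of_le_ne_top hR (measure_mono hPR))
      (ne_top_of_le_ne_top hR (measure_mono hQR)) htop
  obtain ⟨v, -, hv⟩ := exists_setLAverage_le hC Metric.isOpen_ball.measurableSet.nullMeasurableSet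
    (h2 ▸ htop)
  refine ⟨v, ?_⟩
  rwa [setLAverage_eq, ← h2, h1] at hv

/-! ### Coordinates, balls and isometries. -/

/-- The measurable splitting of `ℝᵐ⁺¹` into the first coordinate and the others. -/
noncomputable def euclideanSplit (m : ℕ) :
    EuclideanSpace ℝ (Fin (m + 1)) ≃ᵐ ℝ × (Fin m → ℝ) :=
  (MeasurableEquiv.toLp 2 (Fin (m + 1) → ℝ)).symm.trans
    (MeasurableEquiv.piFinSuccAbove (fun _ => ℝ) 0)

theorem euclideanSplit_symm_apply {m : ℕ} (p : ℝ × (Fin m → ℝ)) :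
    (euclideanSplit m).symm p = WithLp.toLp 2 (Fin.cons p.1 p.2) := by
  exact congrArg (WithLp.toLp 2) (Fin.insertNth_zero' p.1 p.2)

theorem measurePreserving_euclideanSplit_symm (m : ℕ) :
    MeasurePreserving (euclideanSplit m).symm (volume.prod volume) volume :=
  ((volume_preserving_piFinSuccAbove (fun _ : Fin (m + 1) => ℝ) 0).symm _).trans
    ((EuclideanSpace.volume_preserving_symm_measurableEquiv_toLp (Fin (m + 1))).symm _)

theorem volume_euclideanSplit_symm_preimage {m : ℕ} (s : Set (EuclideanSpace ℝ (Fin (m + 1)))) :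
    (volume.prod volume) ((euclideanSplit m).symm ⁻¹' s) = volume s :=
  (measurePreserving_euclideanSplit_symm m).measure_preimage_equiv s

theorem steiner_preimage_ball {m : ℕ} (r : ℝ) :
    steiner ((euclideanSplit m).symm ⁻¹' Metric.ball 0 r) =
      (euclideanSplit m).symm ⁻¹' Metric.ball 0 r := by
  have hmem : ∀ p : ℝ × (Fin m → ℝ), p ∈ (euclideanSplit m).symm ⁻¹' Metric.ball 0 r ↔
      0 < r ∧ p.1 ^ 2 < r ^ 2 - ∑ i, p.2 i ^ 2 := by
    intro p
    rw [Set.mem_preimage, mem_ball_zero_iff, euclideanSplit_symm_apply, EuclideanSpace.norm_eq]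
    simp only [Fin.sum_univ_succ, Fin.cons_zero, Fin.cons_succ, Real.norm_eq_abs, sq_abs]
    by_cases hr : 0 < r
    · rw [Real.sqrt_lt' hr]
      constructor
      · intro h; exact ⟨hr, by linarith⟩
      · intro h; linarith [h.2]
    · simp only [hr, false_and, iff_false, not_lt]
      exact (not_lt.1 hr).trans (Real.sqrt_nonneg _)
  ext ⟨t, y⟩
  rw [hmem, steiner, Set.mem_ofPred_eq]
  by_cases hr : 0 < r
  · have : (fun s : ℝ => (s, y)) ⁻¹' ((euclideanSplit m).symm ⁻¹' Metric.ball 0 r) =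
        Set.Ioo (-√(r ^ 2 - ∑ i, y i ^ 2)) (√(r ^ 2 - ∑ i, y i ^ 2)) := by
      ext s
      rw [Set.mem_preimage, hmem, Set.mem_Ioo, ← abs_lt, Real.lt_sqrt (abs_nonneg _), sq_abs]
      simp [hr]
    simp only [this, Real.volume_Ioo, hr, true_and]
    rw [ENNReal.ofReal_lt_ofReal_iff_of_nonneg (by positivity), sub_neg_eq_add, ← two_mul,
      mul_lt_mul_iff_of_pos_left two_pos, Real.lt_sqrt (abs_nonneg _), sq_abs]
  · have : (fun s : ℝ => (s, y)) ⁻¹' ((euclideanSplit m).symm ⁻¹' Metric.ball 0 r) = ∅ := by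
      ext s
      rw [Set.mem_preimage, hmem]
      simp [hr]
    simp [this, hr]

/-- Two vectors of equal norm are exchanged by the reflection in the hyperplane orthogonal to their
difference. This turns an arbitrary shift into one along the axis of symmetrization. -/
theorem exists_linearIsometryEquiv_apply_eq {m : ℕ} (v : EuclideanSpace ℝ (Fin (m + 1))) :
    ∃ g : EuclideanSpace ℝ (Fin (m + 1)) ≃ₗᵢ[ℝ] EuclideanSpace ℝ (Fin (m + 1)),
      g v = WithLp.toLp 2 (Fin.cons ‖v‖ 0) := by
  refine ⟨_, Submodule.reflection_sub (v := v) (w := WithLp.toLp 2 (Fin.cons ‖v‖ 0)) ?_⟩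
  simp [EuclideanSpace.norm_eq, Fin.sum_univ_succ]

theorem LinearIsometryEquiv.preimage_ball_zero {m : ℕ}
    (g : EuclideanSpace ℝ (Fin (m + 1)) ≃ₗᵢ[ℝ] EuclideanSpace ℝ (Fin (m + 1))) (r : ℝ) :
    g ⁻¹' Metric.ball 0 r = Metric.ball 0 r := by
  ext x; simp

/-- Converts a gain `w` in the overlap `b` with a ball into a loss in the deficit `a`, deficit and
overlap having the fixed finite sum `V`. -/
theorem add_le_of_add_le_of_add_eq {a b a' b' w V : ℝ≥0∞} (hV : V ≠ ∞) (h : a + b = V)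
    (h' : a' + b' = V) (hb : b + w ≤ b') : a' + w ≤ a := by
  have hbt : b ≠ ∞ := ne_top_of_le_ne_top hV (h ▸ le_add_self)
  rw [← ENNReal.add_le_add_iff_right hbt]
  calc a' + w + b = a' + (b + w) := by ring
    _ ≤ a' + b' := by gcongr
    _ = a + b := by rw [h, h']

/-! ### Simultaneous symmetrization of several sets towards balls. -/

section Symmetrization

variable {m : ℕ} {ι : Type*} [Fintype ι]

/-- The properties of the determinant functionals that symmetrization uses. -/
structure IsSteinerMonotone (P : (ι → EuclideanSpace ℝ (Fin (m + 1))) → ℝ≥0∞) : Prop where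
  isometry : ∀ (g : EuclideanSpace ℝ (Fin (m + 1)) ≃ₗᵢ[ℝ] EuclideanSpace ℝ (Fin (m + 1))) y,
    P (fun j => g (y j)) = P y
  linear : ∀ x : ι → Fin m → ℝ, ∃ c : ι → ℝ, ∀ t : ι → ℝ,
    P (fun j => WithLp.toLp 2 (Fin.cons (t j) (x j))) = ENNReal.ofReal |∑ j, c j * t j|
  continuous : Continuous P

/-- Tuples of measurable subsets of a ball with given volumes, on which `P` is at most `S`. -/
structure IsAdmissible (P : (ι → EuclideanSpace ℝ (Fin (m + 1))) → ℝ≥0∞) (S : ℝ≥0∞) (R : ℝ)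
    (V : ι → ℝ≥0∞) (E : ι → Set (EuclideanSpace ℝ (Fin (m + 1)))) : Prop where
  measurableSet : ∀ j, MeasurableSet (E j)
  subset_ball : ∀ j, E j ⊆ Metric.ball 0 R
  volume_eq : ∀ j, volume (E j) = V j
  le : ∀ y, (∀ j, y j ∈ E j) → P y ≤ S

variable {P : (ι → EuclideanSpace ℝ (Fin (m + 1))) → ℝ≥0∞} {S : ℝ≥0∞} {R : ℝ} {V : ι → ℝ≥0∞}
  {E : ι → Set (EuclideanSpace ℝ (Fin (m + 1)))}

theorem IsAdmissible.preimage (hP : IsSteinerMonotone P) (hE : IsAdmissible P S R V E)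
    (g : EuclideanSpace ℝ (Fin (m + 1)) ≃ₗᵢ[ℝ] EuclideanSpace ℝ (Fin (m + 1))) :
    IsAdmissible P S R V (fun j => g ⁻¹' E j) where
  measurableSet j := g.continuous.measurable (hE.measurableSet j)
  subset_ball j := by
    rw [← LinearIsometryEquiv.preimage_ball_zero g]
    exact Set.preimage_mono (hE.subset_ball j)
  volume_eq j := by
    rw [g.measurePreserving.measure_preimage (hE.measurableSet j).nullMeasurableSet, hE.volume_eq]
  le y hy := by
    rw [← hP.isometry g]
    exact hE.le _ hy

theorem IsAdmissible.steiner (hP : IsSteinerMonotone P) (hE : IsAdmissible P S R V E) :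
    IsAdmissible P S R V
      (fun j => euclideanSplit m ⁻¹' steiner ((euclideanSplit m).symm ⁻¹' E j)) where
  measurableSet j := (euclideanSplit m).measurable
    (measurableSet_steiner ((euclideanSplit m).symm.measurable (hE.measurableSet j)))
  subset_ball j := by
    have h := steiner_mono (Set.preimage_mono (f := (euclideanSplit m).symm) (hE.subset_ball j))
    rw [steiner_preimage_ball] at h
    intro x hx
    simpa using h hx
  volume_eq j := by
    rw [← volume_euclideanSplit_symm_preimage, ← Set.preimage_comp,
      MeasurableEquiv.self_comp_symm, Set.preimage_id,
      prod_steiner _ ((euclideanSplit m).symm.measurable (hE.measurableSet j)),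
      volume_euclideanSplit_symm_preimage, hE.volume_eq]
  le y hy := by
    -- Keeping the other coordinates of `y` fixed, the first coordinates can be moved into the
    -- original sections without decreasing `P`.
    obtain ⟨c, hc⟩ := hP.linear fun j => (euclideanSplit m (y j)).2
    obtain ⟨s, hs, hle⟩ := exists_mem_abs_sum_le c (fun j => (euclideanSplit m (y j)).1) _ hy
    have h1 : ∀ j, y j = WithLp.toLp 2
        (Fin.cons (euclideanSplit m (y j)).1 (euclideanSplit m (y j)).2) := fun j => by
      rw [← euclideanSplit_symm_apply, MeasurableEquiv.symm_apply_apply]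
    rw [funext h1, hc]
    refine (ENNReal.ofReal_le_ofReal hle).trans ?_
    rw [← hc]
    refine hE.le _ fun j => ?_
    have := hs j
    rwa [Set.mem_preimage, Set.mem_preimage, euclideanSplit_symm_apply] at this

/-- A rotation followed by a Steiner symmetrization decreases the total deficit by a definite
amount. -/
theorem IsAdmissible.exists_deficit_add_le (hP : IsSteinerMonotone P) {r : ι → ℝ}
    (hr : ∀ j, r j ≤ R) (hR : 0 < R)
    (hV : ∀ j, volume (Metric.ball (0 : EuclideanSpace ℝ (Fin (m + 1))) (r j)) = V j)
    (hE : IsAdmissible P S R V E) {d : ℝ≥0∞} {k : ι}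
    (hk : d ≤ volume (Metric.ball 0 (r k) \ E k)) :
    ∃ E', IsAdmissible P S R V E' ∧
      ∑ j, volume (Metric.ball 0 (r j) \ E' j) +
        d * d / volume (Metric.ball (0 : EuclideanSpace ℝ (Fin (m + 1))) (2 * R)) ≤
      ∑ j, volume (Metric.ball 0 (r j) \ E j) := by
  classical
  have hBm : ∀ j, MeasurableSet (Metric.ball (0 : EuclideanSpace ℝ (Fin (m + 1))) (r j)) :=
    fun j => Metric.isOpen_ball.measurableSet
  have hVt : ∀ j, V j ≠ ∞ := fun j => hV j ▸ measure_ball_lt_top.ne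
  have hC : volume (Metric.ball (0 : EuclideanSpace ℝ (Fin (m + 1))) (2 * R)) ≠ 0 :=
    (Metric.measure_ball_pos _ _ (by positivity)).ne'
  have hC' : volume (Metric.ball (0 : EuclideanSpace ℝ (Fin (m + 1))) (2 * R)) ≠ ∞ :=
    measure_ball_lt_top.ne
  -- The set and its ball have equal finite volume, so the excess outside the ball equals the
  -- deficit inside it.
  have hk' : d ≤ volume (E k \ Metric.ball 0 (r k)) := by
    have h1 := measure_sdiff_add_inter (μ := volume) (E k) (hBm k)
    have h2 := measure_sdiff_add_inter (μ := volume) (Metric.ball 0 (r k)) (hE.measurableSet k)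
    rw [hE.volume_eq] at h1
    rw [Set.inter_comm, hV] at h2
    have h3 : volume (E k ∩ Metric.ball 0 (r k)) ≠ ∞ :=
      ne_top_of_le_ne_top (hVt k) (h1 ▸ le_add_self)
    rwa [(ENNReal.add_left_inj h3).1 (h1.trans h2.symm)]
  obtain ⟨v, hv⟩ := exists_shift_measure_inter_le
    (volume : Measure (EuclideanSpace ℝ (Fin (m + 1))))
    ((hE.measurableSet k).diff (hBm k)) ((hBm k).diff (hE.measurableSet k))
    (Set.sdiff_subset.trans (hE.subset_ball k))
    (Set.sdiff_subset.trans (Metric.ball_subset_ball (hr k))) hC hC'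
  set W := (E k \ Metric.ball 0 (r k)) ∩ (fun x => x - v) ⁻¹' (Metric.ball 0 (r k) \ E k) with hW
  have hWm : MeasurableSet W := ((hE.measurableSet k).diff (hBm k)).inter
    ((measurable_id.sub_const v) ((hBm k).diff (hE.measurableSet k)))
  have hdW : d * d / volume (Metric.ball (0 : EuclideanSpace ℝ (Fin (m + 1))) (2 * R)) ≤
      volume W := le_trans (by gcongr) hv
  obtain ⟨g, hg⟩ := exists_linearIsometryEquiv_apply_eq v
  have hE1 := hE.preimage hP g.symm
  refine ⟨_, hE1.steiner hP, ?_⟩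
  have hprod : ∀ s : Set (EuclideanSpace ℝ (Fin (m + 1))), MeasurableSet s →
      (volume.prod volume) ((euclideanSplit m).symm ⁻¹' (g.symm ⁻¹' s)) = volume s := by
    intro s hs
    rw [volume_euclideanSplit_symm_preimage,
      g.symm.measurePreserving.measure_preimage hs.nullMeasurableSet]
  have key : ∀ j, volume (Metric.ball 0 (r j) \
      (euclideanSplit m ⁻¹' _root_.steiner ((euclideanSplit m).symm ⁻¹' (g.symm ⁻¹' E j)))) +
        (if j = k then volume W else 0) ≤ volume (Metric.ball 0 (r j) \ E j) := by
    intro j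
    -- Taking the empty set for `j ≠ k` treats two claims together: the overlap with ball `k` gains
    -- `W`, and no other overlap shrinks.
    set W' : Set (EuclideanSpace ℝ (Fin (m + 1))) := if j = k then W else ∅ with hW'
    have hW'v : (if j = k then volume W else 0) = volume W' := by
      rw [hW']; split_ifs <;> simp
    have hW'm : MeasurableSet W' := by
      rw [hW']; split_ifs
      · exact hWm
      · exact MeasurableSet.empty
    have hpre : ∀ {s : Set (EuclideanSpace ℝ (Fin (m + 1)))}, MeasurableSet s →
        MeasurableSet ((euclideanSplit m).symm ⁻¹' s) :=
      fun hs => (euclideanSplit m).symm.measurable hs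
    have hst := prod_inter_add_le_prod_steiner_inter (volume : Measure (Fin m → ℝ))
      (hpre (hE1.measurableSet j)) (hpre (hBm j))
      (hpre (g.symm.continuous.measurable hW'm)) (steiner_preimage_ball (r j))
      (by
        rw [hW']
        split_ifs with hjk
        · subst hjk
          intro p hp
          have h3 : g.symm ((euclideanSplit m).symm p) ∈ E j \ Metric.ball 0 (r j) := hp.1
          exact ⟨h3.1, fun h4 => h3.2 (by simpa using h4)⟩
        · simp) ‖v‖
      (by
        rw [hW']
        split_ifs with hjk
        · subst hjk
          intro p hp
          have h3 : g.symm ((euclideanSplit m).symm p) - v ∈ Metric.ball 0 (r j) \ E j := hp.2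
          have h4 : g.symm ((euclideanSplit m).symm p) - v =
              g.symm ((euclideanSplit m).symm (p.1 - ‖v‖, p.2)) := by
            have hgv : g.symm (WithLp.toLp 2 (Fin.cons ‖v‖ 0)) = v := by
              rw [← hg, g.symm_apply_apply]
            nth_rw 1 [← hgv]
            rw [← map_sub]
            congr 1
            simp only [euclideanSplit_symm_apply]
            ext i
            refine Fin.cases ?_ (fun i => ?_) i <;> simp
          rw [h4] at h3
          exact ⟨by simpa using h3.1, h3.2⟩
        · simp)
    have hB1 : (euclideanSplit m).symm ⁻¹' Metric.ball 0 (r j) =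
        (euclideanSplit m).symm ⁻¹' (g.symm ⁻¹' Metric.ball 0 (r j)) := by
      rw [LinearIsometryEquiv.preimage_ball_zero]
    rw [hprod _ hW'm] at hst
    nth_rw 1 [hB1] at hst
    rw [← Set.preimage_inter, ← Set.preimage_inter,
      hprod _ ((hE.measurableSet j).inter (hBm j))] at hst
    have hEq : _root_.steiner ((euclideanSplit m).symm ⁻¹' (g.symm ⁻¹' E j)) ∩
        (euclideanSplit m).symm ⁻¹' Metric.ball 0 (r j) = (euclideanSplit m).symm ⁻¹'
        ((euclideanSplit m ⁻¹' _root_.steiner ((euclideanSplit m).symm ⁻¹' (g.symm ⁻¹' E j))) ∩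
          Metric.ball 0 (r j)) := by
      ext p
      simp
    rw [hEq, volume_euclideanSplit_symm_preimage] at hst
    rw [hW'v]
    refine add_le_of_add_le_of_add_eq (hVt j) ?_ ?_ hst
    · rw [Set.inter_comm, measure_sdiff_add_inter _ (hE.measurableSet j), hV]
    · rw [Set.inter_comm, measure_sdiff_add_inter _ ((hE1.steiner hP).measurableSet j), hV]
  calc _ ≤ ∑ j, (volume (Metric.ball 0 (r j) \
      (euclideanSplit m ⁻¹' _root_.steiner ((euclideanSplit m).symm ⁻¹' (g.symm ⁻¹' E j)))) +
        (if j = k then volume W else 0)) := by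
        rw [Finset.sum_add_distrib, Finset.sum_ite_eq' Finset.univ k, if_pos (Finset.mem_univ k)]
        gcongr
    _ ≤ _ := Finset.sum_le_sum fun j _ => key j

/-- Otherwise each step would lower the total deficit by the same positive `η`, which is impossible
indefinitely because the initial deficit is finite. -/
theorem IsAdmissible.exists_deficit_lt (hP : IsSteinerMonotone P) {r : ι → ℝ}
    (hr : ∀ j, r j ≤ R) (hR : 0 < R)
    (hV : ∀ j, volume (Metric.ball (0 : EuclideanSpace ℝ (Fin (m + 1))) (r j)) = V j)
    (hE : IsAdmissible P S R V E) {d : ℝ≥0∞} (hd : d ≠ 0) :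
    ∃ E', IsAdmissible P S R V E' ∧ ∀ k, volume (Metric.ball 0 (r k) \ E' k) < d := by
  by_contra! hc
  set η := d * d / volume (Metric.ball (0 : EuclideanSpace ℝ (Fin (m + 1))) (2 * R)) with hη
  have hη0 : η ≠ 0 :=
    (ENNReal.div_pos (mul_ne_zero hd hd) measure_ball_lt_top.ne).ne'
  have h : ∀ N : ℕ, ∃ E', IsAdmissible P S R V E' ∧
      ∑ j, volume (Metric.ball 0 (r j) \ E' j) + N * η ≤
        ∑ j, volume (Metric.ball 0 (r j) \ E j) := by
    intro N
    induction N with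
    | zero => exact ⟨E, hE, by simp⟩
    | succ N ih =>
      obtain ⟨E₁, hE₁, hle⟩ := ih
      obtain ⟨k, hk⟩ := hc E₁ hE₁
      obtain ⟨E₂, hE₂, hle₂⟩ := hE₁.exists_deficit_add_le hP hr hR hV hk
      refine ⟨E₂, hE₂, le_trans ?_ hle⟩
      calc _ = (∑ j, volume (Metric.ball 0 (r j) \ E₂ j) + η) + N * η := by push_cast; ring
        _ ≤ _ := by gcongr
  have htop : ∑ j, volume (Metric.ball 0 (r j) \ E j) ≠ ∞ := by
    rw [ENNReal.sum_ne_top]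
    exact fun j _ => ne_top_of_le_ne_top measure_ball_lt_top.ne (measure_mono Set.sdiff_subset)
  obtain ⟨N, hN⟩ := ENNReal.exists_nat_mul_gt hη0 htop
  obtain ⟨_, -, h1⟩ := h N
  exact absurd (le_trans le_add_self h1) (not_le.2 hN)

/-- Among sets of given volumes, centred balls minimize the supremum of the functional. -/
theorem IsSteinerMonotone.le_of_forall_mem (hP : IsSteinerMonotone P)
    (hE : ∀ j, MeasurableSet (E j)) (hER : ∀ j, E j ⊆ Metric.ball 0 R) {r : ι → ℝ}
    (hV : ∀ j, volume (Metric.ball (0 : EuclideanSpace ℝ (Fin (m + 1))) (r j)) = volume (E j))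
    (hS : ∀ y, (∀ j, y j ∈ E j) → P y ≤ S) (y : ι → EuclideanSpace ℝ (Fin (m + 1)))
    (hy : ∀ j, y j ∈ Metric.ball 0 (r j)) : P y ≤ S := by
  obtain ⟨R', hR'⟩ : ∃ R' : ℝ, ∀ j, r j ≤ R' :=
    ⟨∑ j, |r j|, fun j => (le_abs_self _).trans
      (Finset.single_le_sum (f := fun j => |r j|) (fun i _ => abs_nonneg _) (Finset.mem_univ j))⟩
  have hadm : IsAdmissible P S (max (max R R') 1) (fun j => volume (E j)) E :=
    ⟨hE, fun j => (hER j).trans (Metric.ball_subset_ball (by simp)), fun _ => rfl, hS⟩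
  refine le_of_forall_lt fun a ha => ?_
  -- A product neighbourhood of `y` inside the balls on which `P` stays above `a`. A deficit below
  -- the volume of a ball of radius `ρ` forces each `E' k` to meet the `k`-th factor.
  have hnhds : {z | a < P z} ∩ {z | ∀ j, z j ∈ Metric.ball 0 (r j)} ∈ nhds y := by
    refine Filter.inter_mem ((isOpen_lt continuous_const hP.continuous).mem_nhds ha) ?_
    refine IsOpen.mem_nhds ?_ hy
    simp only [Set.ofPred_forall]
    exact isOpen_iInter_of_finite fun j => Metric.isOpen_ball.preimage (continuous_apply j)
  obtain ⟨ρ, hρ, hsub⟩ := Metric.mem_nhds_iff.1 hnhds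
  obtain ⟨E', hE', hlt⟩ := hadm.exists_deficit_lt hP (r := r)
    (fun j => (hR' j).trans (by simp)) (by positivity) hV
    (d := volume (Metric.ball (0 : EuclideanSpace ℝ (Fin (m + 1))) ρ))
    (Metric.measure_ball_pos _ _ hρ).ne'
  have hex : ∀ k, ∃ z ∈ Metric.ball (y k) ρ, z ∈ E' k := by
    intro k
    by_contra! hc
    refine absurd (hlt k) (not_lt.2 ?_)
    rw [← Measure.addHaar_ball_center volume (y k)]
    refine measure_mono fun z hz => ⟨?_, hc z hz⟩
    classical
    have := (hsub (a := Function.update y k z) (by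
      rw [Metric.mem_ball, dist_pi_lt_iff hρ]
      intro j
      by_cases hj : j = k
      · subst hj; simpa using hz
      · simpa [hj] using hρ)).2 k
    simpa using this
  choose z hz hzE using hex
  exact (hsub (by rw [Metric.mem_ball, dist_pi_lt_iff hρ]; exact hz)).1.trans_le (hE'.le z hzE)

end Symmetrization

/-! ### Reduction from arbitrary measurable sets to centred balls. -/

section Reduction

variable {m : ℕ} {ι : Type*} [Fintype ι]

theorem exists_pos_volume_ball_eq (n : ℕ) [NeZero n] {V : ℝ≥0∞} (hV : V ≠ 0) (hV' : V ≠ ∞) :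
    ∃ r : ℝ, 0 < r ∧ volume (Metric.ball (0 : EuclideanSpace ℝ (Fin n)) r) = V := by
  set v := volume (Metric.ball (0 : EuclideanSpace ℝ (Fin n)) 1) with hv
  have hv0 : v ≠ 0 := (Metric.measure_ball_pos _ _ one_pos).ne'
  have hvt : v ≠ ∞ := measure_ball_lt_top.ne
  have hpos : 0 < (V / v).toReal :=
    ENNReal.toReal_pos (ENNReal.div_pos hV hvt).ne' (ENNReal.div_lt_top hV' hv0).ne
  refine ⟨(V / v).toReal ^ (1 / (n : ℝ)), Real.rpow_pos_of_pos hpos _, ?_⟩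
  have : Nonempty (Fin n) := ⟨0⟩
  rw [Measure.addHaar_ball _ _ (Real.rpow_pos_of_pos hpos _).le, finrank_euclideanSpace_fin,
    one_div, Real.rpow_inv_natCast_pow hpos.le (NeZero.ne n),
    ENNReal.ofReal_toReal (ENNReal.div_lt_top hV' hv0).ne, ENNReal.div_mul_cancel hv0 hvt]

/-- Infinite limits must be allowed, and multiplication is discontinuous only where `0` meets `∞`;
nonzero limits avoid this. -/
theorem ENNReal.tendsto_finsetProd_of_ne_zero {ι α : Type*} {l : Filter α} (s : Finset ι)
    {f : ι → α → ℝ≥0∞} {a : ι → ℝ≥0∞} (ha : ∀ i, a i ≠ 0)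
    (h : ∀ i, Filter.Tendsto (f i) l (nhds (a i))) :
    Filter.Tendsto (fun x => ∏ i ∈ s, f i x) l (nhds (∏ i ∈ s, a i)) := by
  classical
  induction s using Finset.induction_on with
  | empty => simpa using tendsto_const_nhds
  | insert i s hi ih =>
    simp_rw [Finset.prod_insert hi]
    exact ENNReal.Tendsto.mul (h i) (Or.inl (ha i)) ih
      (Or.inl (Finset.prod_ne_zero_iff.2 fun j _ => ha j))

/-- An inequality between volumes and a Steiner monotone functional only has to be checked on
centred balls. -/
theorem IsSteinerMonotone.prod_volume_rpow_le
    {P : (ι → EuclideanSpace ℝ (Fin (m + 1))) → ℝ≥0∞} (hP : IsSteinerMonotone P)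
    {p : ℝ} (hp : 0 < p) {C : ℝ≥0∞}
    (hball : ∀ r : ι → ℝ, (∀ j, 0 < r j) →
      ∏ j, volume (Metric.ball (0 : EuclideanSpace ℝ (Fin (m + 1))) (r j)) ^ p ≤
        C * ⨆ (y) (_ : ∀ j, y j ∈ Metric.ball 0 (r j)), P y)
    (E : ι → Set (EuclideanSpace ℝ (Fin (m + 1)))) (hE : ∀ j, NullMeasurableSet (E j) volume) :
    ∏ j, volume (E j) ^ p ≤ C * ⨆ (y) (_ : ∀ j, y j ∈ E j), P y := by
  by_cases h0 : ∃ j, volume (E j) = 0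
  · obtain ⟨j, hj⟩ := h0
    rw [Finset.prod_eq_zero (Finset.mem_univ j) (by rw [hj, ENNReal.zero_rpow_of_pos hp])]
    exact zero_le
  push Not at h0
  -- Measurable subsets of full measure, truncated to bounded sets: passing to subsets can only
  -- lower the supremum, while the volumes converge to those of `E`.
  choose F hFE hFm hFae using fun j => (hE j).exists_measurable_subset_ae_eq
  have htend : Filter.Tendsto (fun N : ℕ => ∏ j, volume (F j ∩ Metric.ball 0 N) ^ p) Filter.atTop
      (nhds (∏ j, volume (E j) ^ p)) := by
    refine ENNReal.tendsto_finsetProd_of_ne_zero _ (fun j h => h0 j ?_) fun j => ?_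
    · simpa [ENNReal.rpow_eq_zero_iff, hp, hp.not_gt] using h
    · refine ((ENNReal.continuous_rpow_const (y := p)).tendsto _).comp ?_
      rw [← measure_congr (hFae j)]
      have hU : F j = ⋃ N : ℕ, F j ∩ Metric.ball 0 N := by
        rw [← Set.inter_iUnion, Metric.iUnion_ball_nat, Set.inter_univ]
      nth_rw 2 [hU]
      refine tendsto_measure_iUnion_atTop fun M N hMN => ?_
      exact Set.inter_subset_inter_right _ (Metric.ball_subset_ball (by exact_mod_cast hMN))
  refine le_of_tendsto' htend fun N => ?_
  by_cases h1 : ∃ j, volume (F j ∩ Metric.ball 0 N) = 0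
  · obtain ⟨j, hj⟩ := h1
    rw [Finset.prod_eq_zero (Finset.mem_univ j) (by rw [hj, ENNReal.zero_rpow_of_pos hp])]
    exact zero_le
  push Not at h1
  choose r hr0 hr using fun j => exists_pos_volume_ball_eq (m + 1) (h1 j)
    (ne_top_of_le_ne_top measure_ball_lt_top.ne (measure_mono Set.inter_subset_right))
  simp_rw [← hr]
  refine (hball r hr0).trans ?_
  refine mul_le_mul_right (iSup₂_le fun y hy => hP.le_of_forall_mem (R := N)
    (fun j => (hFm j).inter Metric.isOpen_ball.measurableSet) (fun j => Set.inter_subset_right)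
    hr (fun z hz => ?_) y hy) C
  exact le_iSup₂_of_le z (fun j => hFE j (hz j).1) le_rfl

end Reduction

/-! ### The determinant functionals, and Hadamard's bound on balls. -/

section PointDet

variable {n : ℕ}

theorem pointDet_cons_zero (y : Fin n → EuclideanSpace ℝ (Fin n)) :
    pointDet (Fin.cons 0 y) = ENNReal.ofReal |(Matrix.of fun i j : Fin n => y j i).det| := by
  simp [pointDet_eq_abs_det]

theorem continuous_pointDet :
    Continuous (pointDet : (Fin (n + 1) → EuclideanSpace ℝ (Fin n)) → ℝ≥0∞) := by
  rw [funext pointDet_eq_abs_det]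
  refine ENNReal.continuous_ofReal.comp (Continuous.abs (Continuous.matrix_det ?_))
  refine continuous_matrix fun i j => ?_
  simp only [Matrix.of_apply]
  fun_prop

open scoped Pointwise in
theorem pointDet_add_linearMap (a : EuclideanSpace ℝ (Fin n))
    (T : EuclideanSpace ℝ (Fin n) →ₗ[ℝ] EuclideanSpace ℝ (Fin n))
    (y : Fin (n + 1) → EuclideanSpace ℝ (Fin n)) :
    pointDet (fun j => a + T (y j)) = ENNReal.ofReal |LinearMap.det T| * pointDet y := by
  have h : Set.range (fun j => a + T (y j)) = a +ᵥ T '' Set.range y := by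
    ext z; simp [Set.mem_vadd_set]
  rw [pointDet, h, convexHull_vadd, measure_vadd, ← LinearMap.image_convexHull,
    Measure.addHaar_image_linearMap, pointDet]
  ring

theorem pointDet_linearIsometryEquiv
    (g : EuclideanSpace ℝ (Fin n) ≃ₗᵢ[ℝ] EuclideanSpace ℝ (Fin n))
    (y : Fin (n + 1) → EuclideanSpace ℝ (Fin n)) : pointDet (fun j => g (y j)) = pointDet y := by
  have h : Set.range (fun j => g (y j)) = g.toLinearEquiv.toLinearMap '' Set.range y := by
    ext z; simp
  rw [pointDet, h, ← LinearMap.image_convexHull, pointDet]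
  congr 1
  refine Eq.trans ?_ (g.symm.measurePreserving.measure_preimage_emb
    g.symm.toHomeomorph.measurableEmbedding _)
  congr 1
  exact g.toEquiv.image_eq_preimage_symm _

theorem isSteinerMonotone_pointDet_cons_zero (m : ℕ) :
    IsSteinerMonotone fun y : Fin (m + 1) → EuclideanSpace ℝ (Fin (m + 1)) =>
      pointDet (Fin.cons 0 y) where
  isometry g y := by
    rw [← pointDet_linearIsometryEquiv g (Fin.cons 0 y)]
    congr 1
    ext j : 1
    refine Fin.cases ?_ (fun j => ?_) j <;> simp
  linear x := by
    -- The cofactors along row `0`, the row containing the first coordinates.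
    refine ⟨fun j => (-1) ^ (j : ℕ) * (Matrix.of fun i k : Fin m => x (j.succAbove k) i).det,
      fun t => ?_⟩
    rw [pointDet_cons_zero, Matrix.det_succ_row_zero]
    congr 2
    refine Finset.sum_congr rfl fun j _ => ?_
    simp only [Matrix.of_apply, Fin.cons_zero]
    rw [mul_right_comm]
    rfl
  continuous := continuous_pointDet.comp (by fun_prop)

theorem isSteinerMonotone_pointDet (m : ℕ) :
    IsSteinerMonotone (pointDet : (Fin (m + 1 + 1) → EuclideanSpace ℝ (Fin (m + 1))) → ℝ≥0∞) where
  isometry g y := pointDet_linearIsometryEquiv g y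
  linear x := by
    set d : Fin (m + 1) → ℝ := fun j => (-1) ^ (j : ℕ) *
      (Matrix.of fun i k : Fin m => x (j.succAbove k).succ i - x 0 i).det with hd
    -- The expansion involves only the differences `t j.succ - t 0`, so the coefficient of `t 0` is
    -- minus the sum of the others.
    refine ⟨Fin.cons (-∑ j, d j) d, fun t => ?_⟩
    rw [pointDet_eq_abs_det, Matrix.det_succ_row_zero]
    congr 2
    rw [Fin.sum_univ_succ (fun j => _ * t j)]
    simp only [Fin.cons_zero, Fin.cons_succ]
    rw [neg_mul, Finset.sum_mul, neg_add_eq_sub, ← Finset.sum_sub_distrib]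
    refine Finset.sum_congr rfl fun j _ => ?_
    rw [← mul_sub, hd, mul_right_comm]
    rfl
  continuous := continuous_pointDet

/-- A bound for the functional on a product of open balls extends to the closed balls. -/
theorem le_of_forall_mem_ball {ι : Type*} {P : (ι → EuclideanSpace ℝ (Fin n)) → ℝ≥0∞}
    (hP : Continuous P) {r : ι → ℝ} (hr : ∀ j, 0 < r j) {S : ℝ≥0∞}
    (hS : ∀ y, (∀ j, y j ∈ Metric.ball 0 (r j)) → P y ≤ S) {y : ι → EuclideanSpace ℝ (Fin n)}
    (hy : ∀ j, ‖y j‖ ≤ r j) : P y ≤ S := by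
  have h : y ∈ closure (Set.univ.pi fun j => Metric.ball (0 : EuclideanSpace ℝ (Fin n)) (r j)) := by
    rw [closure_pi_set]
    intro j _
    change y j ∈ closure (Metric.ball (0 : EuclideanSpace ℝ (Fin n)) (r j))
    rw [closure_ball _ (hr j).ne']
    simpa using hy j
  refine closure_minimal (fun z hz => ?_) (isClosed_le hP (continuous_const (y := S))) h
  exact hS z fun j => hz j trivial

/-- Hadamard's inequality. -/
theorem abs_det_le_prod_norm (v : Fin n → EuclideanSpace ℝ (Fin n)) :
    |(Matrix.of fun i j : Fin n => v j i).det| ≤ ∏ j, ‖v j‖ := by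
  have : Fact (Module.finrank ℝ (EuclideanSpace ℝ (Fin n)) = n) := ⟨finrank_euclideanSpace_fin⟩
  set b := EuclideanSpace.basisFun (Fin n) ℝ
  have h := b.toBasis.orientation.abs_volumeForm_apply_le v
  rw [Orientation.volumeForm_robust _ b rfl, Module.Basis.det_apply] at h
  exact h

theorem prod_volume_ball_rpow {k : ℕ} (hk : k ≠ 0) [NeZero n] (r : Fin k → ℝ)
    (hr : ∀ j, 0 < r j) :
    ∏ j, volume (Metric.ball (0 : EuclideanSpace ℝ (Fin n)) (r j)) ^ (1 / (k : ℝ)) =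
      volume (Metric.ball (0 : EuclideanSpace ℝ (Fin n)) 1) *
        ENNReal.ofReal (∏ j, (r j ^ n) ^ (1 / (k : ℝ))) := by
  have : Nonempty (Fin n) := ⟨0⟩
  have h : ∀ j, volume (Metric.ball (0 : EuclideanSpace ℝ (Fin n)) (r j)) ^ (1 / (k : ℝ)) =
      ENNReal.ofReal ((r j ^ n) ^ (1 / (k : ℝ))) *
        volume (Metric.ball (0 : EuclideanSpace ℝ (Fin n)) 1) ^ (1 / (k : ℝ)) := by
    intro j
    rw [Measure.addHaar_ball _ _ (hr j).le, finrank_euclideanSpace_fin,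
      ENNReal.mul_rpow_of_nonneg _ _ (by positivity),
      ENNReal.ofReal_rpow_of_nonneg (pow_nonneg (hr j).le _) (by positivity)]
  simp_rw [h]
  rw [Finset.prod_mul_distrib, Finset.prod_const, Finset.card_univ, Fintype.card_fin,
    ← ENNReal.rpow_natCast, ← ENNReal.rpow_mul, one_div, inv_mul_cancel₀ (by exact_mod_cast hk),
    ENNReal.rpow_one, mul_comm, ENNReal.ofReal_prod_of_nonneg]
  intro j _
  have := hr j
  positivity

theorem supDetZero_ball (r : Fin n → ℝ) (hr : ∀ j, 0 < r j) :
    supDetZero (fun j => Metric.ball (0 : EuclideanSpace ℝ (Fin n)) (r j)) =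
      ENNReal.ofReal (∏ j, r j) := by
  refine le_antisymm (iSup₂_le fun y hy => ?_) ?_
  · rw [pointDet_cons_zero]
    refine ENNReal.ofReal_le_ofReal ((abs_det_le_prod_norm y).trans ?_)
    exact Finset.prod_le_prod (fun _ _ => norm_nonneg _)
      fun j _ => (mem_ball_zero_iff.1 (hy j)).le
  · have h := le_of_forall_mem_ball (P := fun y => pointDet (Fin.cons 0 y))
      (continuous_pointDet.comp (by fun_prop)) hr
      (S := supDetZero (fun j => Metric.ball (0 : EuclideanSpace ℝ (Fin n)) (r j)))
      (fun y hy => le_iSup₂_of_le y hy le_rfl)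
      (y := fun j => EuclideanSpace.single j (r j)) (fun j => by simp [abs_of_pos (hr j)])
    refine le_of_eq_of_le ?_ h
    rw [pointDet_cons_zero]
    have : (Matrix.of fun i j : Fin n => EuclideanSpace.single j (r j) i) = Matrix.diagonal r := by
      ext i j
      by_cases hij : i = j
      · subst hij; simp
      · simp [hij]
    rw [this, Matrix.det_diagonal, abs_of_pos (Finset.prod_pos fun j _ => hr j)]

end PointDet

/-! ### Regular simplices and the arithmetic-geometric mean inequality. -/

section Simplex

variable {n : ℕ}

/-- The square matrix with columns `(a j, y j)`. -/
def augMatrix (a : Fin (n + 1) → ℝ) (y : Fin (n + 1) → EuclideanSpace ℝ (Fin n)) :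
    Matrix (Fin (n + 1)) (Fin (n + 1)) ℝ :=
  Matrix.of fun i j => Fin.cons (α := fun _ => ℝ) (a j) (y j) i

/-- Subtracting column `0` from the others leaves `c` as the only nonzero entry of the top row. A
general `c` allows the height of the lifted points to be optimized in `pointDet_le_of_norm_le`. -/
theorem det_augMatrix_const (c : ℝ) (y : Fin (n + 1) → EuclideanSpace ℝ (Fin n)) :
    (augMatrix (fun _ => c) y).det =
      c * (Matrix.of fun i j : Fin n => y j.succ i - y 0 i).det := by
  rw [← Matrix.det_transpose, Matrix.det_eq_of_forall_row_eq_smul_add_const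
    (A := (augMatrix (fun _ => c) y).transpose)
    (B := (Matrix.of fun i j => augMatrix (fun _ => c) y i j -
      (if j = 0 then 0 else 1) * augMatrix (fun _ => c) y i 0).transpose)
    (fun j => if j = 0 then 0 else 1) 0 (by simp) (by
      intro i j
      simp)]
  rw [Matrix.det_transpose, Matrix.det_succ_row_zero, Fin.sum_univ_succ]
  have h : ∀ j : Fin n, (Matrix.of fun i j => augMatrix (fun _ => c) y i j -
      (if j = 0 then 0 else 1) * augMatrix (fun _ => c) y i 0) 0 j.succ = 0 := by
    intro j
    simp [augMatrix]
  simp only [h, mul_zero, zero_mul, Finset.sum_const_zero, add_zero]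
  simp only [Fin.val_zero, pow_zero, one_mul]
  congr 1
  · simp [augMatrix]
  · congr 1
    ext i j
    simp [augMatrix]

theorem pointDet_eq_abs_det_augMatrix (y : Fin (n + 1) → EuclideanSpace ℝ (Fin n)) :
    pointDet y = ENNReal.ofReal |(augMatrix (fun _ => 1) y).det| := by
  rw [pointDet_eq_abs_det, det_augMatrix_const, one_mul]

/-- The normalized determinant of a regular simplex inscribed in the unit sphere. -/
noncomputable def regularSimplexDet (n : ℕ) : ℝ := √((n : ℝ) + 1) ^ (n + 1) / √(n : ℝ) ^ n

theorem constB_eq (n : ℕ) : constB n =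
    volume (Metric.ball (0 : EuclideanSpace ℝ (Fin n)) 1) *
      ENNReal.ofReal (regularSimplexDet n)⁻¹ := by
  rw [constB, regularSimplexDet, inv_div, Real.rpow_div_two_eq_sqrt _ (by positivity),
    Real.rpow_div_two_eq_sqrt _ (by positivity), Real.rpow_natCast]
  congr 3
  exact_mod_cast Real.rpow_natCast (√((n : ℝ) + 1)) (n + 1)

theorem regularSimplexDet_pos [NeZero n] : 0 < regularSimplexDet n := by
  have : 0 < (n : ℝ) := by exact_mod_cast Nat.pos_of_ne_zero (NeZero.ne n)
  unfold regularSimplexDet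
  positivity

/-- Hadamard's inequality for the lifted vectors `(r / √n, y j)`. At this height the lifted vertices
of a regular simplex inscribed in the sphere of radius `r` are orthogonal, since their inner
products before lifting are `-r ^ 2 / n`; the bound is therefore sharp. -/
theorem pointDet_le_of_norm_le [NeZero n] {r : ℝ} (hr : 0 < r)
    (y : Fin (n + 1) → EuclideanSpace ℝ (Fin n)) (hy : ∀ j, ‖y j‖ ≤ r) :
    pointDet y ≤ ENNReal.ofReal (regularSimplexDet n * r ^ n) := by
  have hn : 0 < (n : ℝ) := by exact_mod_cast Nat.pos_of_ne_zero (NeZero.ne n)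
  rw [pointDet_eq_abs_det]
  refine ENNReal.ofReal_le_ofReal ?_
  have h := abs_det_le_prod_norm (fun j : Fin (n + 1) =>
    (WithLp.toLp 2 (Fin.cons (r / √n) (y j)) : EuclideanSpace ℝ (Fin (n + 1))))
  have hb : ∀ j : Fin (n + 1),
      ‖(WithLp.toLp 2 (Fin.cons (r / √n) (y j)) : EuclideanSpace ℝ (Fin (n + 1)))‖ ≤
        r * √((n : ℝ) + 1) / √n := by
    intro j
    rw [EuclideanSpace.norm_eq]
    refine Real.sqrt_le_iff.2 ⟨by positivity, ?_⟩
    simp only [Fin.sum_univ_succ, Fin.cons_zero, Fin.cons_succ, Real.norm_eq_abs, sq_abs]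
    have h1 : ∑ i, y j i ^ 2 ≤ r ^ 2 := by
      rw [← EuclideanSpace.real_norm_sq_eq]
      exact pow_le_pow_left₀ (norm_nonneg _) (hy j) 2
    rw [div_pow, div_pow, mul_pow, Real.sq_sqrt hn.le, Real.sq_sqrt (by positivity)]
    calc r ^ 2 / n + ∑ i, y j i ^ 2 ≤ r ^ 2 / n + r ^ 2 := by gcongr
      _ = _ := by field_simp; ring
  have h2 := h.trans (Finset.prod_le_prod (fun _ _ => norm_nonneg _) fun j _ => hb j)
  change |(augMatrix (fun _ => r / √n) y).det| ≤ _ at h2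
  rw [det_augMatrix_const, abs_mul, abs_of_pos (by positivity), Finset.prod_const,
    Finset.card_univ, Fintype.card_fin, mul_comm, ← le_div_iff₀ (by positivity)] at h2
  refine h2.trans (le_of_eq ?_)
  rw [regularSimplexDet, div_pow, mul_pow]
  field_simp
  ring

/-- The directions of the vertices of a regular simplex. -/
theorem exists_regularSimplex [NeZero n] : ∃ w : Fin (n + 1) → EuclideanSpace ℝ (Fin n),
    (∀ j, ‖w j‖ = 1) ∧ ∀ r : Fin (n + 1) → ℝ, (∀ j, 0 < r j) →
      pointDet (fun j => r j • w j) =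
        ENNReal.ofReal (regularSimplexDet n * ((∏ j, r j) * ∑ j, 1 / ((n : ℝ) + 1) * (r j)⁻¹)) := by
  have hn : 0 < (n : ℝ) := by exact_mod_cast Nat.pos_of_ne_zero (NeZero.ne n)
  set q : ℝ := √((n : ℝ) + 1) with hq
  have hq0 : 0 < q := by positivity
  have hq2 : q ^ 2 = n + 1 := Real.sq_sqrt (by positivity)
  set s : ℝ := √(n : ℝ) with hs
  have hs0 : 0 < s := by positivity
  have hs2 : s ^ 2 = n := Real.sq_sqrt (by positivity)
  -- Complete the unit diagonal vector to an orthonormal basis. Deleting the constant top row of the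
  -- resulting orthogonal matrix leaves columns of squared norm `n / (n + 1)`; scaling by `q / s`
  -- makes them unit vectors.
  obtain ⟨b, hb⟩ := Orthonormal.exists_orthonormalBasis_extension_of_card_eq (𝕜 := ℝ)
    (E := EuclideanSpace ℝ (Fin (n + 1))) (ι := Fin (n + 1)) (by simp)
    (v := fun _ => WithLp.toLp 2 fun _ => q⁻¹) (s := {0}) (by
      refine ⟨fun i => ?_, fun i j hij => absurd (Subsingleton.elim i j) hij⟩
      simp [Set.domRestrict, EuclideanSpace.norm_eq, ← hq2]
      field_simp)
  have hb0 : ∀ j, b 0 j = q⁻¹ := fun j => by rw [hb 0 rfl]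
  set Q : Matrix (Fin (n + 1)) (Fin (n + 1)) ℝ := Matrix.of fun i j => b i j with hQ
  have hQQ : Q * Q.transpose = 1 := by
    ext i j
    rw [Matrix.mul_apply, Matrix.one_apply]
    have := (orthonormal_iff_ite.1 b.orthonormal) i j
    rw [← this]
    simp [hQ, PiLp.inner_apply, mul_comm]
  have hQQ' : Q.transpose * Q = 1 := mul_eq_one_comm.1 hQQ
  have hQdet : |Q.det| = 1 := by
    have := congrArg Matrix.det hQQ
    rw [Matrix.det_mul, Matrix.det_transpose, Matrix.det_one] at this
    rwa [← abs_mul_abs_self, mul_self_eq_one_iff, or_iff_left (by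
      linarith [abs_nonneg Q.det])] at this
  refine ⟨fun j => WithLp.toLp 2 fun i => q / s * b i.succ j, fun j => ?_, fun r hr => ?_⟩
  · have h1 := congrFun (congrFun hQQ' j) j
    rw [Matrix.mul_apply, Matrix.one_apply_eq, Fin.sum_univ_succ] at h1
    simp only [Matrix.transpose_apply, hQ, Matrix.of_apply, hb0] at h1
    rw [← sq_eq_sq₀ (norm_nonneg _) zero_le_one, EuclideanSpace.real_norm_sq_eq]
    simp only [mul_pow, ← Finset.mul_sum]
    have h2 : ∑ i : Fin n, b i.succ j ^ 2 = 1 - (q ^ 2)⁻¹ := by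
      simp only [pow_two, mul_inv]; linarith
    rw [h2, div_pow, hq2, hs2]
    field_simp
    ring
  · rw [pointDet_eq_abs_det_augMatrix]
    congr 1
    have h1 : (augMatrix (fun _ => 1)
        (fun j => r j • (WithLp.toLp 2 fun i => q / s * b i.succ j :
          EuclideanSpace ℝ (Fin n)))) = Matrix.of fun i j => r j *
        (Matrix.of fun i j => (Fin.cons 1 (fun _ => q / s) : Fin (n + 1) → ℝ) i *
          (augMatrix (fun j => (r j)⁻¹)
            (fun j => (WithLp.toLp 2 fun i => b i.succ j : EuclideanSpace ℝ (Fin n)))) i j) i j := by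
      ext i j
      refine Fin.cases ?_ (fun i => ?_) i
      · simp [augMatrix, (hr j).ne']
      · simp [augMatrix]
    -- Only the top row differs from that of `Q`, so multiplying by the transpose of `Q` gives
    -- identity rows below it, and the determinant is the corner entry.
    have h2 : (augMatrix (fun j => (r j)⁻¹)
            (fun j => (WithLp.toLp 2 fun i => b i.succ j : EuclideanSpace ℝ (Fin n))) *
          Q.transpose).det = ∑ j, (r j)⁻¹ * q⁻¹ := by
      rw [Matrix.det_succ_column_zero, Fin.sum_univ_succ]
      have h3 : ∀ i : Fin n, (augMatrix (fun j => (r j)⁻¹)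
            (fun j => (WithLp.toLp 2 fun i => b i.succ j : EuclideanSpace ℝ (Fin n))) *
          Q.transpose) i.succ = (1 : Matrix (Fin (n + 1)) (Fin (n + 1)) ℝ) i.succ := by
        intro i
        rw [← hQQ]
        ext j
        simp [Matrix.mul_apply, augMatrix, hQ]
      have h4 : (augMatrix (fun j => (r j)⁻¹)
            (fun j => (WithLp.toLp 2 fun i => b i.succ j : EuclideanSpace ℝ (Fin n))) *
          Q.transpose).submatrix (Fin.succAbove 0) Fin.succ = 1 := by
        ext i j
        simp [h3, Matrix.one_apply]
      rw [h4, Matrix.det_one, Finset.sum_eq_zero fun i _ => by simp [h3]]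
      simp [Matrix.mul_apply, augMatrix, hQ, hb0]
    rw [Matrix.det_mul, Matrix.det_transpose] at h2
    have h5 := congrArg abs h2
    rw [abs_mul, hQdet, mul_one] at h5
    have hrp : ∀ j, 0 < (r j)⁻¹ := fun j => inv_pos.2 (hr j)
    rw [h1, Matrix.det_mul_row, Matrix.det_mul_column, abs_mul, abs_mul, h5,
      abs_of_pos (Finset.prod_pos fun j _ => hr j), abs_of_nonneg (a := ∑ j, _)
        (Finset.sum_nonneg fun j _ => (mul_pos (hrp j) (inv_pos.2 hq0)).le),
      Fin.prod_univ_succ (fun i => (Fin.cons 1 (fun _ => q / s) : Fin (n + 1) → ℝ) i)]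
    simp only [Fin.cons_zero, Fin.cons_succ, Finset.prod_const, Finset.card_univ,
      Fintype.card_fin, one_mul]
    rw [abs_of_pos (by positivity), ← Finset.sum_mul, ← Finset.mul_sum, ← hq2,
      regularSimplexDet, ← hq, ← hs, div_pow, pow_succ]
    field_simp

theorem le_supDet_ball [NeZero n] (r : Fin (n + 1) → ℝ) (hr : ∀ j, 0 < r j) :
    ENNReal.ofReal (regularSimplexDet n * ((∏ j, r j) * ∑ j, 1 / ((n : ℝ) + 1) * (r j)⁻¹)) ≤
      supDet (fun j => Metric.ball (0 : EuclideanSpace ℝ (Fin n)) (r j)) := by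
  obtain ⟨w, hw, h⟩ := exists_regularSimplex (n := n)
  rw [← h r hr]
  refine le_of_forall_mem_ball continuous_pointDet hr (fun y hy => le_iSup₂_of_le y hy le_rfl)
    fun j => ?_
  rw [norm_smul, hw, mul_one, Real.norm_eq_abs, abs_of_pos (hr j)]

theorem prod_mul_inv_rpow (r : Fin (n + 1) → ℝ) (hr : ∀ j, 0 < r j) :
    ∏ j, ((∏ i, r i) * (r j)⁻¹) ^ (1 / ((n : ℝ) + 1)) =
      ∏ j, (r j ^ n) ^ (1 / ((n : ℝ) + 1)) := by
  have hr' : 0 < ∏ i, r i := Finset.prod_pos fun j _ => hr j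
  rw [Real.finsetProd_rpow _ _ fun j _ => (mul_pos hr' (inv_pos.2 (hr j))).le,
    Real.finsetProd_rpow _ _ fun j _ => pow_nonneg (hr j).le _]
  congr 1
  rw [Finset.prod_mul_distrib, Finset.prod_const, Finset.card_univ, Fintype.card_fin,
    Finset.prod_inv_distrib, Finset.prod_pow, pow_succ]
  field_simp

/-- The arithmetic-geometric mean inequality for the numbers `(∏ i, r i) * (r j)⁻¹`, with equal
weights. -/
theorem prod_rpow_le_prod_mul_sum (r : Fin (n + 1) → ℝ) (hr : ∀ j, 0 < r j) :
    ∏ j, (r j ^ n) ^ (1 / ((n : ℝ) + 1)) ≤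
      (∏ j, r j) * ∑ j, 1 / ((n : ℝ) + 1) * (r j)⁻¹ := by
  have hr' : 0 < ∏ i, r i := Finset.prod_pos fun j _ => hr j
  rw [← prod_mul_inv_rpow r hr, Finset.mul_sum]
  refine (Real.geom_mean_le_arith_mean_weighted Finset.univ (fun _ => 1 / ((n : ℝ) + 1)) _
    (fun _ _ => by positivity) ?_ fun j _ => (mul_pos hr' (inv_pos.2 (hr j))).le).trans
    (le_of_eq (Finset.sum_congr rfl fun j _ => by ring))
  simp
  field_simp

theorem prod_rpow_lt_prod_mul_sum (r : Fin (n + 1) → ℝ) (hr : ∀ j, 0 < r j) {k l : Fin (n + 1)}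
    (hkl : r k ≠ r l) :
    ∏ j, (r j ^ n) ^ (1 / ((n : ℝ) + 1)) <
      (∏ j, r j) * ∑ j, 1 / ((n : ℝ) + 1) * (r j)⁻¹ := by
  have hr' : 0 < ∏ i, r i := Finset.prod_pos fun j _ => hr j
  rw [← prod_mul_inv_rpow r hr, Finset.mul_sum]
  refine ((Real.geom_mean_lt_arith_mean_weighted_iff_of_pos Finset.univ
    (fun _ => 1 / ((n : ℝ) + 1)) _
    (fun _ _ => by positivity) ?_ fun j _ => (mul_pos hr' (inv_pos.2 (hr j))).le).2
      ⟨k, Finset.mem_univ _, l, Finset.mem_univ _, ?_⟩).trans_eq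
    (Finset.sum_congr rfl fun j _ => by ring)
  · simp
    field_simp
  · simpa [hr'.ne'] using hkl

end Simplex

/-! ### Sharp constants, equality for balls, and affine images. -/

section Sharp

variable {n : ℕ}

theorem prod_volume_ball_rpow_succ [NeZero n] (r : Fin (n + 1) → ℝ) (hr : ∀ j, 0 < r j) :
    ∏ j, volume (Metric.ball (0 : EuclideanSpace ℝ (Fin n)) (r j)) ^ (1 / ((n : ℝ) + 1)) =
      volume (Metric.ball (0 : EuclideanSpace ℝ (Fin n)) 1) *
        ENNReal.ofReal (∏ j, (r j ^ n) ^ (1 / ((n : ℝ) + 1))) := by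
  exact_mod_cast prod_volume_ball_rpow (n := n) n.succ_ne_zero r hr

theorem prod_volume_ball_eq_constA_mul [NeZero n] (r : Fin n → ℝ) (hr : ∀ j, 0 < r j) :
    ∏ j, volume (Metric.ball (0 : EuclideanSpace ℝ (Fin n)) (r j)) ^ (1 / (n : ℝ)) =
      constA n * supDetZero (fun j => Metric.ball 0 (r j)) := by
  rw [prod_volume_ball_rpow (NeZero.ne n) r hr, supDetZero_ball r hr, constA]
  congr 3 with j
  rw [one_div, Real.pow_rpow_inv_natCast (hr j).le (NeZero.ne n)]

theorem constB_mul_ofReal_regularSimplexDet_mul [NeZero n] (x : ℝ) :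
    constB n * ENNReal.ofReal (regularSimplexDet n * x) =
      volume (Metric.ball (0 : EuclideanSpace ℝ (Fin n)) 1) * ENNReal.ofReal x := by
  rw [constB_eq, mul_assoc,
    ← ENNReal.ofReal_mul (inv_nonneg.2 (regularSimplexDet_pos (n := n)).le),
    inv_mul_cancel_left₀ (regularSimplexDet_pos (n := n)).ne']

theorem prod_volume_ball_le_constB_mul [NeZero n] (r : Fin (n + 1) → ℝ) (hr : ∀ j, 0 < r j) :
    ∏ j, volume (Metric.ball (0 : EuclideanSpace ℝ (Fin n)) (r j)) ^ (1 / ((n : ℝ) + 1)) ≤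
      constB n * supDet (fun j => Metric.ball 0 (r j)) := by
  rw [prod_volume_ball_rpow_succ r hr]
  calc _ ≤ volume (Metric.ball (0 : EuclideanSpace ℝ (Fin n)) 1) * ENNReal.ofReal
          ((∏ j, r j) * ∑ j, 1 / ((n : ℝ) + 1) * (r j)⁻¹) := by
        gcongr
        exact prod_rpow_le_prod_mul_sum r hr
    _ ≤ _ := by
        rw [← constB_mul_ofReal_regularSimplexDet_mul]
        gcongr
        exact le_supDet_ball r hr

/-- The lower bound from the regular simplex suffices: the mean inequality is already strict, so the
exact supremum for unequal radii is not needed. -/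
theorem prod_volume_ball_lt_constB_mul [NeZero n] (r : Fin (n + 1) → ℝ) (hr : ∀ j, 0 < r j)
    {k l : Fin (n + 1)} (hkl : r k ≠ r l) :
    ∏ j, volume (Metric.ball (0 : EuclideanSpace ℝ (Fin n)) (r j)) ^ (1 / ((n : ℝ) + 1)) <
      constB n * supDet (fun j => Metric.ball 0 (r j)) := by
  have hlt := prod_rpow_lt_prod_mul_sum r hr hkl
  rw [prod_volume_ball_rpow_succ r hr]
  calc _ < volume (Metric.ball (0 : EuclideanSpace ℝ (Fin n)) 1) * ENNReal.ofReal
          ((∏ j, r j) * ∑ j, 1 / ((n : ℝ) + 1) * (r j)⁻¹) := by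
        refine ENNReal.mul_lt_mul_right (Metric.measure_ball_pos _ _ one_pos).ne'
          measure_ball_lt_top.ne ?_
        refine (ENNReal.ofReal_lt_ofReal_iff (lt_of_le_of_lt ?_ hlt)).2 hlt
        exact Finset.prod_nonneg fun j _ => Real.rpow_nonneg (pow_nonneg (hr j).le _) _
    _ ≤ _ := by
        rw [← constB_mul_ofReal_regularSimplexDet_mul]
        gcongr
        exact le_supDet_ball r hr

theorem constB_mul_supDet_ball_le [NeZero n] {r : ℝ} (hr : 0 < r) :
    constB n * supDet (fun _ => Metric.ball (0 : EuclideanSpace ℝ (Fin n)) r) ≤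
      volume (Metric.ball (0 : EuclideanSpace ℝ (Fin n)) r) := by
  have : Nonempty (Fin n) := ⟨0⟩
  rw [Measure.addHaar_ball _ _ hr.le, finrank_euclideanSpace_fin, mul_comm (ENNReal.ofReal _),
    ← constB_mul_ofReal_regularSimplexDet_mul]
  gcongr
  exact iSup₂_le fun y hy =>
    pointDet_le_of_norm_le hr y fun j => (mem_ball_zero_iff.1 (hy j)).le

theorem prod_rpow_const {k : ℕ} (hk : k ≠ 0) (a : ℝ≥0∞) :
    ∏ _j : Fin k, a ^ (1 / (k : ℝ)) = a := by
  rw [Finset.prod_const, Finset.card_univ, Fintype.card_fin, ← ENNReal.rpow_natCast,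
    ← ENNReal.rpow_mul, one_div, inv_mul_cancel₀ (by exact_mod_cast hk), ENNReal.rpow_one]

theorem prod_rpow_const_succ (a : ℝ≥0∞) :
    ∏ _j : Fin (n + 1), a ^ (1 / ((n : ℝ) + 1)) = a := by
  exact_mod_cast prod_rpow_const n.succ_ne_zero a

theorem volume_ball_eq_constA_mul [NeZero n] {r : ℝ} (hr : 0 < r) :
    volume (Metric.ball (0 : EuclideanSpace ℝ (Fin n)) r) =
      constA n * supDetZero (fun _ => Metric.ball (0 : EuclideanSpace ℝ (Fin n)) r) := by
  rw [← prod_volume_ball_eq_constA_mul _ fun _ => hr, prod_rpow_const (NeZero.ne n)]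

theorem volume_ball_eq_constB_mul [NeZero n] {r : ℝ} (hr : 0 < r) :
    volume (Metric.ball (0 : EuclideanSpace ℝ (Fin n)) r) =
      constB n * supDet (fun _ => Metric.ball (0 : EuclideanSpace ℝ (Fin n)) r) := by
  refine le_antisymm ?_ (constB_mul_supDet_ball_le hr)
  refine le_of_eq_of_le ?_ (prod_volume_ball_le_constB_mul _ fun _ => hr)
  rw [prod_rpow_const_succ]

theorem supDetZero_image (T : EuclideanSpace ℝ (Fin n) →ₗ[ℝ] EuclideanSpace ℝ (Fin n))
    (s : Set (EuclideanSpace ℝ (Fin n))) :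
    supDetZero (fun _ => T '' s) =
      ENNReal.ofReal |LinearMap.det T| * supDetZero (fun _ => s) := by
  have key : ∀ x : Fin n → EuclideanSpace ℝ (Fin n), pointDet (Fin.cons 0 fun j => T (x j)) =
      ENNReal.ofReal |LinearMap.det T| * pointDet (Fin.cons 0 x) := by
    intro x
    rw [← pointDet_add_linearMap 0 T]
    congr 1
    ext j : 1
    refine Fin.cases ?_ (fun j => ?_) j <;> simp
  simp only [supDetZero, ENNReal.mul_iSup]
  refine le_antisymm (iSup₂_le fun y hy => ?_) (iSup₂_le fun x hx => ?_)
  · choose x hx hxy using hy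
    obtain rfl : (fun j => T (x j)) = y := funext hxy
    exact le_iSup₂_of_le x hx (key x).le
  · exact le_iSup₂_of_le (fun j => T (x j)) (fun j => ⟨x j, hx j, rfl⟩) (key x).ge

theorem supDet_image (a : EuclideanSpace ℝ (Fin n))
    (T : EuclideanSpace ℝ (Fin n) →ₗ[ℝ] EuclideanSpace ℝ (Fin n))
    (s : Set (EuclideanSpace ℝ (Fin n))) :
    supDet (fun _ => (fun x => a + T x) '' s) =
      ENNReal.ofReal |LinearMap.det T| * supDet (fun _ => s) := by
  simp only [supDet, ENNReal.mul_iSup]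
  refine le_antisymm (iSup₂_le fun y hy => ?_) (iSup₂_le fun x hx => ?_)
  · choose x hx hxy using hy
    obtain rfl : (fun j => a + T (x j)) = y := funext hxy
    exact le_iSup₂_of_le x hx (pointDet_add_linearMap a T x).le
  · exact le_iSup₂_of_le (fun j => a + T (x j)) (fun j => ⟨x j, hx j, rfl⟩)
      (pointDet_add_linearMap a T x).ge

theorem volume_image_add_linearMap (a : EuclideanSpace ℝ (Fin n))
    (T : EuclideanSpace ℝ (Fin n) →ₗ[ℝ] EuclideanSpace ℝ (Fin n))
    (s : Set (EuclideanSpace ℝ (Fin n))) :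
    volume ((fun x => a + T x) '' s) = ENNReal.ofReal |LinearMap.det T| * volume s := by
  rw [← Measure.addHaar_image_linearMap, ← Set.image_image (fun x => a + x) T,
    Set.image_add_left, measure_preimage_add]

/-- One case of equality with finite nonzero volume identifies the best constant: `s` is then finite
and nonzero and can be cancelled. The condition on `A` excludes `0 * ∞`. -/
theorem le_of_mul_eq_of_le_mul {a A C s : ℝ≥0∞} (h0 : a ≠ 0) (ht : a ≠ ∞) (hA : A ≠ 0)
    (h : a = A * s) (hC : a ≤ C * s) : A ≤ C := by
  have hs0 : s ≠ 0 := by rintro rfl; exact h0 (by rw [h, mul_zero])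
  have hst : s ≠ ∞ := by rintro rfl; exact ht (by rw [h, ENNReal.mul_top hA])
  exact (ENNReal.mul_le_mul_iff_left hs0 hst).1 (h ▸ hC)

end Sharp

theorem mainTheorem5 (n : ℕ) (hn : 1 ≤ n) :
    -- the multilinear inequality with one vertex at the origin
    (IsLeast {C : ℝ≥0∞ | ∀ E : Fin n → Set (EuclideanSpace ℝ (Fin n)),
        (∀ j, NullMeasurableSet (E j) volume) →
          ∏ j, volume (E j) ^ (1 / (n : ℝ)) ≤ C * supDetZero E} (constA n) ∧
      ∀ r : Fin n → ℝ, (∀ j, 0 < r j) →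
        ∏ j, volume (Metric.ball (0 : EuclideanSpace ℝ (Fin n)) (r j)) ^ (1 / (n : ℝ)) =
          constA n * supDetZero (fun j => Metric.ball 0 (r j))) ∧
    -- the multilinear inequality with `n + 1` free vertices
    (IsLeast {C : ℝ≥0∞ | ∀ E : Fin (n + 1) → Set (EuclideanSpace ℝ (Fin n)),
        (∀ j, NullMeasurableSet (E j) volume) →
          ∏ j, volume (E j) ^ (1 / ((n : ℝ) + 1)) ≤ C * supDet E} (constB n) ∧
      ∀ r : Fin (n + 1) → ℝ, (∀ j, 0 < r j) →
        (∏ j, volume (Metric.ball (0 : EuclideanSpace ℝ (Fin n)) (r j)) ^ (1 / ((n : ℝ) + 1)) =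
          constB n * supDet (fun j => Metric.ball 0 (r j)) ↔ ∀ i j, r i = r j)) ∧
    -- the inequality for one set, with one vertex at the origin
    (IsLeast {C : ℝ≥0∞ | ∀ E : Set (EuclideanSpace ℝ (Fin n)), NullMeasurableSet E volume →
        volume E ≤ C * supDetZero (fun _ => E)} (constA n) ∧
      ∀ (r : ℝ) (T : EuclideanSpace ℝ (Fin n) ≃ₗ[ℝ] EuclideanSpace ℝ (Fin n)), 0 < r →
        volume (T '' Metric.ball 0 r) =
          constA n * supDetZero (fun _ => T '' Metric.ball 0 r)) ∧
    -- the inequality for one set, with `n + 1` free vertices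
    (IsLeast {C : ℝ≥0∞ | ∀ E : Set (EuclideanSpace ℝ (Fin n)), NullMeasurableSet E volume →
        volume E ≤ C * supDet (fun _ => E)} (constB n) ∧
      ∀ (r : ℝ) (a : EuclideanSpace ℝ (Fin n))
        (T : EuclideanSpace ℝ (Fin n) ≃ₗ[ℝ] EuclideanSpace ℝ (Fin n)), 0 < r →
        volume ((fun x => a + T x) '' Metric.ball 0 r) =
          constB n * supDet (fun _ => (fun x => a + T x) '' Metric.ball 0 r)) := by
  obtain ⟨m, rfl⟩ : ∃ m, n = m + 1 := ⟨n - 1, by omega⟩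
  have hAmul : ∀ E : Fin (m + 1) → Set (EuclideanSpace ℝ (Fin (m + 1))),
      (∀ j, NullMeasurableSet (E j) volume) →
      ∏ j, volume (E j) ^ (1 / ((m + 1 : ℕ) : ℝ)) ≤ constA (m + 1) * supDetZero E :=
    (isSteinerMonotone_pointDet_cons_zero m).prod_volume_rpow_le (by positivity)
      fun r hr => (prod_volume_ball_eq_constA_mul r hr).le
  have hBmul : ∀ E : Fin (m + 1 + 1) → Set (EuclideanSpace ℝ (Fin (m + 1))),
      (∀ j, NullMeasurableSet (E j) volume) →
      ∏ j, volume (E j) ^ (1 / (((m + 1 : ℕ) : ℝ) + 1)) ≤ constB (m + 1) * supDet E :=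
    (isSteinerMonotone_pointDet m).prod_volume_rpow_le (by positivity)
      fun r hr => prod_volume_ball_le_constB_mul r hr
  have hv0 : volume (Metric.ball (0 : EuclideanSpace ℝ (Fin (m + 1))) 1) ≠ 0 :=
    (Metric.measure_ball_pos _ _ one_pos).ne'
  have hvt : volume (Metric.ball (0 : EuclideanSpace ℝ (Fin (m + 1))) 1) ≠ ∞ :=
    measure_ball_lt_top.ne
  have hB0 : constB (m + 1) ≠ 0 := by
    rw [constB_eq]
    exact mul_ne_zero hv0
      (ENNReal.ofReal_pos.2 (inv_pos.2 (regularSimplexDet_pos (n := m + 1)))).ne'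
  have hball : NullMeasurableSet (Metric.ball (0 : EuclideanSpace ℝ (Fin (m + 1))) 1) volume :=
    Metric.isOpen_ball.measurableSet.nullMeasurableSet
  have hleastA : ∀ {C : ℝ≥0∞}, volume (Metric.ball (0 : EuclideanSpace ℝ (Fin (m + 1))) 1) ≤
      C * supDetZero (fun _ => Metric.ball (0 : EuclideanSpace ℝ (Fin (m + 1))) 1) →
      constA (m + 1) ≤ C :=
    le_of_mul_eq_of_le_mul hv0 hvt hv0 (volume_ball_eq_constA_mul one_pos)
  have hleastB : ∀ {C : ℝ≥0∞}, volume (Metric.ball (0 : EuclideanSpace ℝ (Fin (m + 1))) 1) ≤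
      C * supDet (fun _ => Metric.ball (0 : EuclideanSpace ℝ (Fin (m + 1))) 1) →
      constB (m + 1) ≤ C :=
    le_of_mul_eq_of_le_mul hv0 hvt hB0 (volume_ball_eq_constB_mul one_pos)
  -- The unit ball witnesses minimality of all four constants. The one-set inequalities are the
  -- multilinear ones for constant families, and equality passes to ellipsoids because both sides
  -- scale by `|LinearMap.det T|`.
  refine ⟨⟨⟨hAmul, fun C hC => hleastA ?_⟩, prod_volume_ball_eq_constA_mul⟩,
    ⟨⟨hBmul, fun C hC => hleastB ?_⟩, fun r hr => ⟨fun h i j => ?_, fun h => ?_⟩⟩,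
    ⟨⟨fun E hE => ?_, fun C hC => hleastA (hC _ hball)⟩, fun r T hr => ?_⟩,
    ⟨⟨fun E hE => ?_, fun C hC => hleastB (hC _ hball)⟩, fun r a T hr => ?_⟩⟩
  · have h := hC (fun _ => Metric.ball 0 1) fun _ => hball
    rwa [prod_rpow_const (NeZero.ne _)] at h
  · have h := hC (fun _ => Metric.ball 0 1) fun _ => hball
    rwa [prod_rpow_const_succ] at h
  · by_contra hij
    exact (prod_volume_ball_lt_constB_mul r hr hij).ne h
  · simp_rw [h _ 0]
    rw [prod_rpow_const_succ]
    exact volume_ball_eq_constB_mul (hr 0)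
  · have h := hAmul (fun _ => E) fun _ => hE
    rwa [prod_rpow_const (NeZero.ne _)] at h
  · refine (Measure.addHaar_image_linearMap volume T.toLinearMap _).trans ?_
    rw [volume_ball_eq_constA_mul hr, mul_left_comm, ← supDetZero_image]
    rfl
  · have h := hBmul (fun _ => E) fun _ => hE
    rwa [prod_rpow_const_succ] at h
  · refine (volume_image_add_linearMap a T.toLinearMap _).trans ?_
    rw [volume_ball_eq_constB_mul hr, mul_left_comm, ← supDet_image a]
    rfl
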